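/- Let $n\ge 1$ and $[n]=\{1<\dots<n\}$. A column is a nonempty strictly increasing sequence $c=(c^1<\dots<c^k)$ in $[n]$, drawn from top to bottom, with $|c|=k$. A string of columns $c_1|_{p_1}c_2|_{p_2}\cdots|_{p_{m}}c_{m+1}$ (possibly empty) glues columns at positions $p_i\in\mathbb Z$: in $c|_qc'$ the bottom box of $c'$ is in the $q$-th row of $c$. Call $c|_qc'$ admissible if $c,c'$ share at least one row ($1\le q\le |c|+|c'|-1$) and, in each shared row, the entry of $c$ is $\le$ the entry of $c'$. A Young tableau is a string of columns with $|c_{i+1}|\le|c_i|$, $p_i=|c_{i+1}|$ and each $c_i|_{p_i}c_{i+1}$ admissible; a quasi-ribbon tableau is one with $p_i=|c_i|+|c_{i+1}|-1$ and each $c_i|_{p_i}c_{i+1}$ admissible. Their sets are $\mathrm{Young}_n$ and $\mathrm{QuasiR}_n$. The reading $R_{SW}$ reads the columns from left to right, each from bottom to top. Right-bottom sliding. Each rule below replaces two adjacent columns $c,c'$, glued at position $q$, leaving all other columns of the string where they stand in the plane. Write $k=|c|$, $l=|c'|$. To split $c|_qc'$ means: take the smallest $p\in\{0,\dots,k-1\}$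 such that the place of row $p$ of $c$ (for $p=0$, the row just above $c$) contains a box $c'^m$ of $c'$ with $c^p\le c'^m<c^{p+1}$ (for $p=0$ only $c'^m<c^1$ is required), if there is one, and replace the two columns by $(c^1,\dots,c^p)$, $(c'^1,\dots,c'^m,c^{p+1},\dots,c^k)$, $(c'^{m+1},\dots,c'^l)$, where the boxes moved to the right stay in their rows and empty columns are deleted. The rules are: ($\alpha$) if $c|_qc'$ is admissible, split it; ($\delta^\alpha$) if $c|_qc'$ is not admissible, move $c'$ vertically to the largest admissible position $P$, or to $P=0$ (on top of $c$) if there is none, and split $c|_Pc'$; ($\gamma$) if $c|_qc'$ is admissible, or $q<1$ and $c^1\le c'^l$, move $c'$ to the largest admissible position $P$, provided $P\ne q$; ($\delta$) if $q>k$, $c$ and $c'$ share no row and $c^k\le c'^1$, move $c'$ up to position $k+l-1$. The right-bottom rectification $\mathrm{rba}(d)$ of $d\in\mathrm{Young}_n$ is its normal form for the rewriting relation generated by these rules. A right (resp. left) string data structure is a set $D$ with an element $\emptyset$, an insertion map $I:D\times[n]\to D$ and a reading map $R:D\to[n]^*$ such that $R(I(\emptyset,x))=x$ for $x\in[n]$,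 $R$ is injective, $R(\emptyset)$ is the empty word, the insertion of the word $R(d)$ in $\emptyset$, letter by letter from left to right (resp. from right to left), gives $d$ for all $d\in D$, and the product on $D$ sending $(d,d')$ to the result of inserting the word $R(d')$ in $d$ is associative. Its constructor $C$ sends a word to the result of its insertion in $\emptyset$. A morphism $(D,I,R)\to(D',I',R')$ between two right (resp. two left) such structures is a map $f:D\to D'$ with $f(\emptyset)=\emptyset'$, $f(I(d,x))=I'(f(d),x)$ and $C'(R(d))=C'(R'(f(d)))$ for all $d\in D$, $x\in[n]$. With reading $R_{SW}$ and distinguished element the empty string, let $\mathrm{Yrow}_n$ (right) and $\mathrm{Ycol}_n$ (left) be the structures on $\mathrm{Young}_n$ given by Schensted's row insertion and Schensted's column insertion, and let $\mathrm{Qrow}_n$ (right) and $\mathrm{Qleft}_n$ (left) be those on $\mathrm{QuasiR}_n$ given by the right and left insertions: the right one puts $x$ just after the last entry $\le x$ (rows read from top to bottom, each from left to right) and moves the entries that followed it in its row to a new row just below, or, if there is no such entry, makes $x$ a new first row; the left one puts $x$ just before the first entry $\ge x$ and moves the entries that preceded it in its row to a new row just above, or, if there is no such entry, makes $x$ a new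 last row. Theorem. Every Young tableau $d$ has exactly one normal form $\mathrm{rba}(d)$; it is a quasi-ribbon tableau; $\mathrm{Yrow}_n,\mathrm{Qrow}_n$ are right and $\mathrm{Ycol}_n,\mathrm{Qleft}_n$ are left string data structures; and $\mathrm{rba}:\mathrm{Young}_n\to\mathrm{QuasiR}_n$ is a surjective map that is a morphism of string data structures both from $\mathrm{Yrow}_n$ to $\mathrm{Qrow}_n$ and from $\mathrm{Ycol}_n$ to $\mathrm{Qleft}_n$. -/

import Mathlib

namespace StringColumns

/-! ### Strings of columns

A column over `[n]` is stored as the list `[u¹, …, uᵏ]` of its entries from top to bottom. -/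

/-- Raw data of a string of columns `u₁ |_{p₁} u₂ |_{p₂} ⋯ c_{m+1}`: the columns from left to right
and the gluing sequence. -/
@[ext] structure GluedString (n : ℕ) where
  cols : List (List (Fin n))
  glue : List ℤ

/-- A (nonempty) column: its entries strictly increase from top to bottom. -/
def IsColumn {n : ℕ} (u : List (Fin n)) : Prop :=
  u ≠ [] ∧ u.Pairwise (· < ·)

/-- The set of strings of columns over `[n]`. The empty column is the unit of the gluing
operation, so it occurs only as the empty string. -/
def Scol (n : ℕ) : Set (GluedString n) :=
  {w | (∀ u ∈ w.cols, IsColumn u) ∧ w.glue.length = w.cols.length - 1}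

/-- The empty string of columns. -/
def emptyString (n : ℕ) : GluedString n := ⟨[], []⟩

/-- The string of columns with prescribed columns and with gluing positions given by a gluing
map. -/
def ofGluingMap {n : ℕ} (g : List (Fin n) → List (Fin n) → ℤ) (L : List (List (Fin n))) :
    GluedString n :=
  ⟨L, List.zipWith g L L.tail⟩

/-- South-west reading: columns from left to right, each one from bottom to top. -/
def readSW {n : ℕ} (w : GluedString n) : List (Fin n) :=
  w.cols.flatMap List.reverse

/-! In `u |_q u'` the bottom box of `u'` stands in the `q`-th row of `u`, the first row of `u`
having number `1`. With indices starting from `0`, the boxes `u[a]` and `u'[b]` are thus in the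
same row iff `b + q = a + |u'|`. -/

/-- All the full rows of `u |_q u'` are increasing. -/
def RowIncreasing {n : ℕ} (u : List (Fin n)) (q : ℤ) (u' : List (Fin n)) : Prop :=
  ∀ a b : ℕ, (b : ℤ) + q = a + u'.length → ∀ x ∈ u[a]?, ∀ y ∈ u'[b]?, x ≤ y

/-- `u |_q u'` is row connected: some row contains a box of both columns. -/
def RowConnected {n : ℕ} (u : List (Fin n)) (q : ℤ) (u' : List (Fin n)) : Prop :=
  1 ≤ q ∧ q ≤ u.length + u'.length - 1

/-- `u |_q u'` is row connected and row increasing. -/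
def InScolc {n : ℕ} (u : List (Fin n)) (q : ℤ) (u' : List (Fin n)) : Prop :=
  RowConnected u q u' ∧ RowIncreasing u q u'

/-- The gluing map of Young tableaux. -/
def youngGlue {n : ℕ} (_u u' : List (Fin n)) : ℤ := u'.length

/-- The gluing map of quasi-ribbon tableaux. -/
def ribbonGlue {n : ℕ} (u u' : List (Fin n)) : ℤ := u.length + u'.length - 1

/-- Young tableaux over `[n]`: top-justified columns of weakly decreasing lengths, whose rows
are weakly increasing. -/
def Young (n : ℕ) : Set (GluedString n) :=
  {w | w ∈ Scol n ∧ w = ofGluingMap youngGlue w.cols ∧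
    w.cols.IsChain (fun u u' => u'.length ≤ u.length ∧ InScolc u (youngGlue u u') u')}

/-- Quasi-ribbon tableaux over `[n]`: the top box of each column is in the row of the bottom box
of the preceding column, and the rows are weakly increasing. -/
def QuasiRibbon (n : ℕ) : Set (GluedString n) :=
  {w | w ∈ Scol n ∧ w = ofGluingMap ribbonGlue w.cols ∧
    w.cols.IsChain (fun u u' => InScolc u (ribbonGlue u u') u')}

/-! ### The right-bottom sliding rewriting system

The rules are written for columns placed in the plane. A placed column `(t, u)` has its top box in
the row number `t`, rows being numbered downwards by `ℤ`. A rule replaces two adjacent columns and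
leaves the other columns of the string where they are. -/

abbrev Placed (n : ℕ) := ℤ × List (Fin n)

/-- The gluing position of two adjacent placed columns. -/
def gluingPosition {n : ℕ} (x y : Placed n) : ℤ := y.1 + y.2.length - x.1

/-- The string of columns given by a sequence of placed columns. -/
def ofPlaced {n : ℕ} (D : List (Placed n)) : GluedString n :=
  ⟨D.map (fun x => x.2), List.zipWith gluingPosition D D.tail⟩

/-- In `u |_q u'`, the boxes `uᵖ` and `u'ᵐ` (numbered from `1`) are in the same row and
`uᵖ ≤ u'ᵐ < uᵖ⁺¹`. For `p = 0` the place to the left of `u'ᵐ`, just above `u¹`, is empty and only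
`u'ᵐ < u¹` is required. -/
def IsSplit {n : ℕ} (u : List (Fin n)) (q : ℤ) (u' : List (Fin n)) (p m : ℕ) : Prop :=
  p < u.length ∧ 1 ≤ m ∧ m ≤ u'.length ∧ (m : ℤ) + q = p + u'.length ∧
    (∀ y ∈ u'[m - 1]?, ∀ x ∈ u[p]?, y < x) ∧
    (p ≠ 0 → ∀ x ∈ u[p - 1]?, ∀ y ∈ u'[m - 1]?, x ≤ y)

/-- The split whose `p` is minimal. -/
def IsMinSplit {n : ℕ} (u : List (Fin n)) (q : ℤ) (u' : List (Fin n)) (p m : ℕ) : Prop :=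
  IsSplit u q u' p m ∧ ∀ p' m' : ℕ, IsSplit u q u' p' m' → p ≤ p'

/-- The result of sliding to the right, along their rows, the boxes of `(t, u)` below the `p`-th
one, under the first `m` boxes of `(t', u')`, and the remaining boxes of `u'` into a new column.
Empty columns are removed. -/
def slideRight {n : ℕ} (t : ℤ) (u : List (Fin n)) (t' : ℤ) (u' : List (Fin n)) (p m : ℕ) :
    List (Placed n) :=
  [(t, u.take p), (t', u'.take m ++ u.drop p), (t' + m, u'.drop m)].filter
    (fun x => !x.2.isEmpty)

/-- The rules of the right-bottom sliding system. `Rule x y T`: the adjacent placed columns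
`x`, `y` are replaced by the sequence `T`. -/
inductive Rule {n : ℕ} : Placed n → Placed n → List (Placed n) → Prop
  /-- Right sliding. -/
  | alpha (t : ℤ) (u : List (Fin n)) (t' : ℤ) (u' : List (Fin n)) (p m : ℕ)
      (h : InScolc u (gluingPosition (t, u) (t', u')) u')
      (hs : IsMinSplit u (gluingPosition (t, u) (t', u')) u' p m) :
      Rule (t, u) (t', u') (slideRight t u t' u' p m)
  /-- If `u |_q u'` is not row connected and row increasing, `u'` is moved to the lowest place `P`
  where it is (on top of `u`, which is `P = 0`, if there is none), and then a right sliding is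
  performed. -/
  | deltaAlpha (t : ℤ) (u : List (Fin n)) (t' : ℤ) (u' : List (Fin n)) (P : ℤ) (p m : ℕ)
      (h : ¬ InScolc u (gluingPosition (t, u) (t', u')) u')
      (hP : IsGreatest {P : ℤ | P = 0 ∨ InScolc u P u'} P)
      (hs : IsMinSplit u P u' p m) :
      Rule (t, u) (t', u') (slideRight t u (t + P - u'.length) u' p m)
  /-- Bottom sliding: `u'` goes down to the lowest place `P` where `u |_P u'` is row connected and
  row increasing, if it is not already there. -/
  | gamma (t : ℤ) (u : List (Fin n)) (t' : ℤ) (u' : List (Fin n)) (P : ℤ)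
      (h : InScolc u (gluingPosition (t, u) (t', u')) u' ∨
        (gluingPosition (t, u) (t', u') < 1 ∧ ∀ x ∈ u.head?, ∀ y ∈ u'.getLast?, x ≤ y))
      (hP : IsGreatest {P : ℤ | InScolc u P u'} P)
      (hne : P ≠ gluingPosition (t, u) (t', u')) :
      Rule (t, u) (t', u') [(t, u), (t + P - u'.length, u')]
  /-- Top sliding: `u'` lies below `u` and goes up until its top box is in the row of the bottom
  box of `u`. -/
  | delta (t : ℤ) (u : List (Fin n)) (t' : ℤ) (u' : List (Fin n))
      (hq : (u.length : ℤ) < gluingPosition (t, u) (t', u'))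
      (hc : ¬ RowConnected u (gluingPosition (t, u) (t', u')) u')
      (h : ∀ x ∈ u.getLast?, ∀ y ∈ u'.head?, x ≤ y) :
      Rule (t, u) (t', u') [(t, u), (t + u.length - 1, u')]

/-- One rewriting step on strings of columns. -/
def Step {n : ℕ} (w w' : GluedString n) : Prop :=
  w ∈ Scol n ∧ ∃ (A B : List (Placed n)) (x y : Placed n) (T : List (Placed n)),
    Rule x y T ∧ w = ofPlaced (A ++ [x, y] ++ B) ∧ w' = ofPlaced (A ++ T ++ B)

/-- `v` is a normal form of `w`. -/
def IsNormalFormOf {n : ℕ} (w v : GluedString n) : Prop :=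
  Relation.ReflTransGen Step w v ∧ ∀ v', ¬ Step v v'

open Classical in
/-- The right-bottom rectification: the normal form of a string of columns (the value is irrelevant
if there is no normal form). -/
noncomputable def rba {n : ℕ} (w : GluedString n) : GluedString n :=
  if h : ∃ v, IsNormalFormOf w v then h.choose else w

/-! ### String data structures -/

/-- The data of a string data structure over `[n]`: the underlying set `D`, with its distinguished
element, the insertion map and the reading map. -/
structure StringData (n : ℕ) (α : Type*) where
  carrier : Set α
  empty : α
  ins : α → Fin n → α
  read : α → List (Fin n)

namespace StringData

variable {n : ℕ} {α β : Type*}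

/-- Insertion of a word, letter by letter from left to right. -/
def insRight (S : StringData n α) (d : α) (u : List (Fin n)) : α := u.foldl S.ins d

/-- Insertion of a word, letter by letter from right to left. -/
def insLeft (S : StringData n α) (u : List (Fin n)) (d : α) : α := u.foldr (fun x e => S.ins e x) d

/-- The constructor of a right string data structure. -/
def constrRight (S : StringData n α) (u : List (Fin n)) : α := S.insRight S.empty u

/-- The constructor of a left string data structure. -/
def constrLeft (S : StringData n α) (u : List (Fin n)) : α := S.insLeft u S.empty

/-- The axioms of (associative) right string data structures. -/
structure IsRight (S : StringData n α) : Prop where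
  empty_mem : S.empty ∈ S.carrier
  ins_mem : ∀ d ∈ S.carrier, ∀ x, S.ins d x ∈ S.carrier
  read_letter : ∀ x, S.read (S.ins S.empty x) = [x]
  constr_read : ∀ d ∈ S.carrier, S.constrRight (S.read d) = d
  read_injOn : Set.InjOn S.read S.carrier
  read_empty : S.read S.empty = []
  assoc : ∀ d ∈ S.carrier, ∀ d' ∈ S.carrier, ∀ d'' ∈ S.carrier,
    S.insRight (S.insRight d (S.read d')) (S.read d'') =
      S.insRight d (S.read (S.insRight d' (S.read d'')))

/-- The axioms of (associative) left string data structures. -/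
structure IsLeft (S : StringData n α) : Prop where
  empty_mem : S.empty ∈ S.carrier
  ins_mem : ∀ d ∈ S.carrier, ∀ x, S.ins d x ∈ S.carrier
  read_letter : ∀ x, S.read (S.ins S.empty x) = [x]
  constr_read : ∀ d ∈ S.carrier, S.constrLeft (S.read d) = d
  read_injOn : Set.InjOn S.read S.carrier
  read_empty : S.read S.empty = []
  assoc : ∀ d ∈ S.carrier, ∀ d' ∈ S.carrier, ∀ d'' ∈ S.carrier,
    S.insLeft (S.read d'') (S.insLeft (S.read d') d) =
      S.insLeft (S.read (S.insLeft (S.read d'') d')) d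

/-- Morphisms of right string data structures. -/
structure IsRightMorphism (S : StringData n α) (S' : StringData n β) (f : α → β) : Prop where
  mapsTo : Set.MapsTo f S.carrier S'.carrier
  map_empty : f S.empty = S'.empty
  map_ins : ∀ d ∈ S.carrier, ∀ x, f (S.ins d x) = S'.ins (f d) x
  constr_read : ∀ d ∈ S.carrier, S'.constrRight (S.read d) = S'.constrRight (S'.read (f d))

/-- Morphisms of left string data structures. -/
structure IsLeftMorphism (S : StringData n α) (S' : StringData n β) (f : α → β) : Prop where
  mapsTo : Set.MapsTo f S.carrier S'.carrier
  map_empty : f S.empty = S'.empty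
  map_ins : ∀ d ∈ S.carrier, ∀ x, f (S.ins d x) = S'.ins (f d) x
  constr_read : ∀ d ∈ S.carrier, S'.constrLeft (S.read d) = S'.constrLeft (S'.read (f d))

end StringData

/-! ### Schensted's insertions -/

/-- Insertion of `x` in the list of lines (rows or columns) of a tableau by bumping: `x` is put at
the end of the first line if `r a x` holds for all the entries `a` of this line; otherwise it
replaces the first entry `y` with `¬ r y x`, and `y` is inserted in the next lines. -/
def bump {n : ℕ} (r : Fin n → Fin n → Bool) : List (List (Fin n)) → Fin n → List (List (Fin n))
  | [], x => [[x]]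
  | l :: ls, x =>
    match l.dropWhile (fun a => r a x) with
    | [] => (l ++ [x]) :: ls
    | y :: l' => (l.takeWhile (fun a => r a x) ++ x :: l') :: bump r ls y

/-- Exchange of the rows and the columns of a Young tableau. -/
def transpose {n : ℕ} (L : List (List (Fin n))) : List (List (Fin n)) :=
  (List.range ((L.map List.length).foldr max 0)).map (fun i => L.filterMap (fun u => u[i]?))

/-- Schensted's right insertion, by row bumping. -/
def schenstedRight {n : ℕ} (w : GluedString n) (x : Fin n) : GluedString n :=
  ofGluingMap youngGlue (transpose (bump (fun a b => decide (a ≤ b)) (transpose w.cols) x))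

/-- Schensted's left insertion, by column bumping. -/
def schenstedLeft {n : ℕ} (w : GluedString n) (x : Fin n) : GluedString n :=
  ofGluingMap youngGlue (bump (fun a b => decide (a < b)) w.cols x)

/-! ### Insertions in quasi-ribbon tableaux -/

/-- Exchange of the rows and the columns of a ribbon: the list of rows in terms of the list of
columns, and conversely. The last box of a line is the first box of the crossing line
that goes through the first box of the next line. -/
def ribbonTranspose {n : ℕ} : List (List (Fin n)) → List (List (Fin n))
  | [] => []
  | u :: us =>
    match ribbonTranspose us with
    | [] => u.map (fun a => [a])
    | r :: rs => u.dropLast.map (fun a => [a]) ++ (u.getLast?.toList ++ r) :: rs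

/-- Right insertion in the rows of a quasi-ribbon tableau with an entry `≤ x`: `x` is put
after the last such entry, and the entries that followed it in its row go to a new row
below. The result is `none` if all the entries are `> x`. -/
def ribbonRightAux {n : ℕ} : List (List (Fin n)) → Fin n → Option (List (List (Fin n)))
  | [], _ => none
  | r :: rs, x =>
    match ribbonRightAux rs x with
    | some rs' => some (r :: rs')
    | none =>
      match r.rdropWhile (fun a => decide (x < a)) with
      | [] => none
      | a :: l => some (((a :: l) ++ [x]) ::
          ([r.rtakeWhile (fun a => decide (x < a))].filter (fun l => !l.isEmpty) ++ rs))

/-- Right insertion in the rows of a quasi-ribbon tableau. -/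
def ribbonRight {n : ℕ} (R : List (List (Fin n))) (x : Fin n) : List (List (Fin n)) :=
  (ribbonRightAux R x).getD ([x] :: R)

/-- Left insertion in the rows of a quasi-ribbon tableau: `x` is put before the first
entry `≥ x`, and the entries that preceded it in its row stay in a row above; if there is no
such entry, `x` is a new last row. -/
def ribbonLeft {n : ℕ} : List (List (Fin n)) → Fin n → List (List (Fin n))
  | [], x => [[x]]
  | r :: rs, x =>
    match r.dropWhile (fun a => decide (a < x)) with
    | [] => r :: ribbonLeft rs x
    | a :: l => [r.takeWhile (fun a => decide (a < x))].filter (fun l => !l.isEmpty) ++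
        (x :: a :: l) :: rs

/-- The right insertion in quasi-ribbon tableaux. -/
def quasiRight {n : ℕ} (w : GluedString n) (x : Fin n) : GluedString n :=
  ofGluingMap ribbonGlue (ribbonTranspose (ribbonRight (ribbonTranspose w.cols) x))

/-- The left insertion in quasi-ribbon tableaux. -/
def quasiLeft {n : ℕ} (w : GluedString n) (x : Fin n) : GluedString n :=
  ofGluingMap ribbonGlue (ribbonTranspose (ribbonLeft (ribbonTranspose w.cols) x))

/-! ### The four string data structures -/

/-- Young tableaux with Schensted's right insertion. -/
def Yrow (n : ℕ) : StringData n (GluedString n) :=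
  ⟨Young n, emptyString n, schenstedRight, readSW⟩

/-- Young tableaux with Schensted's left insertion. -/
def Ycol (n : ℕ) : StringData n (GluedString n) :=
  ⟨Young n, emptyString n, schenstedLeft, readSW⟩

/-- Quasi-ribbon tableaux with the right insertion. -/
def Qrow (n : ℕ) : StringData n (GluedString n) :=
  ⟨QuasiRibbon n, emptyString n, quasiRight, readSW⟩

/-- Quasi-ribbon tableaux with the left insertion. -/
def Qleft (n : ℕ) : StringData n (GluedString n) :=
  ⟨QuasiRibbon n, emptyString n, quasiLeft, readSW⟩

end StringColumns

/-!
# Rectification of Young tableaux into quasi-ribbon tableaux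

Everything is controlled by two congruences on words. The plactic congruence is generated by Knuth's
relations. The hypoplactic congruence is described by invariants: two words are congruent if they
have the same content and if, for any two letters `a < b` with no letter of the words between them,
`b` occurs before `a` in both or in neither. Knuth's relations preserve these invariants, so the
plactic congruence is finer (`Plactic.hypoplactic`).

The readings of Young tableaux are a cross-section of the plactic congruence, and those of
quasi-ribbon tableaux are a cross-section of the hypoplactic one. In the first case, column
insertion of words is invariant under Knuth's relations (`foldr_columnBump_congr`), and the
insertion of the reading of a tableau gives it back. In the second case, the sorted content and the
invariants determine the steps of the ribbon (`IsRibbon.eq_of_hypoplactic`). Each of the four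
insertions multiplies the class of the reading by the inserted letter, on the right or on the left.
A cross-section with such an insertion is a string data structure
(`StringData.isRight_of_crossSection`, `StringData.isLeft_of_crossSection`), since all the axioms
become equalities of classes.

For Schensted's right insertion, which bumps in rows, and for both insertions in ribbons, it is
natural to read the rows from bottom to top. This row reading is congruent to the column reading
(`plactic_rowReading_transpose`, `hypoplactic_columnReading_rowReading`).

Every rule of the sliding system preserves the hypoplactic class of the reading (`Rule.spec`), and
the irreducible strings of columns are exactly the quasi-ribbon tableaux (`irreducible_iff`), so a
string has at most one normal form: the quasi-ribbon tableau in the class of its reading. There is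
one because a slide makes the reading lexicographically smaller or removes a column, while the moves
that do not slide can be made from left to right, each pair of columns being treated once
(`exists_reduction`). Thus rectification is the passage from the plactic class of the reading to its
hypoplactic class, which explains surjectivity and the compatibility with the insertions.
-/

namespace StringColumns

/-! ### Congruences on words -/

section Words

variable {α : Type*}

/-- A congruence of the free monoid of words that is finer than the commutation of letters. -/
structure IsWordCongruence (E : List α → List α → Prop) : Prop where
  refl : ∀ u, E u u
  symm : ∀ {u v}, E u v → E v u
  trans : ∀ {u v w}, E u v → E v w → E u w
  append : ∀ {u u' v v'}, E u u' → E v v' → E (u ++ v) (u' ++ v')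
  perm : ∀ {u v}, E u v → u.Perm v

theorem pair_sublist_append {a b : α} {u v : List α} :
    [b, a].Sublist (u ++ v) ↔ [b, a].Sublist u ∨ (b ∈ u ∧ a ∈ v) ∨ [b, a].Sublist v := by
  induction u with
  | nil => simp
  | cons c u ih =>
    simp only [List.cons_append, List.cons_sublist_cons', ih, List.singleton_sublist,
      List.mem_append, List.mem_cons]
    grind

theorem pair_sublist_cons {a b c : α} {v : List α} :
    [b, a].Sublist (c :: v) ↔ (b = c ∧ a ∈ v) ∨ [b, a].Sublist v := by
  simpa using pair_sublist_append (a := a) (b := b) (u := [c]) (v := v)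

variable [LinearOrder α]

/-- The hypoplactic congruence, by its invariants: two words are congruent if they have the same
letters with the same multiplicities and if, for all letters `a < b` with no letter of the words
strictly between them, `b` occurs before `a` in both words or in none. -/
def Hypoplactic (w w' : List α) : Prop :=
  w.Perm w' ∧ ∀ a b, a < b → (∀ c ∈ w, c ≤ a ∨ b ≤ c) →
    ([b, a].Sublist w ↔ [b, a].Sublist w')

theorem Hypoplactic.isWordCongruence : IsWordCongruence (Hypoplactic (α := α)) where
  refl u := ⟨.refl _, fun _ _ _ _ => Iff.rfl⟩
  symm h := ⟨h.1.symm, fun a b hab hc =>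
    (h.2 a b hab fun c hcw => hc c (h.1.mem_iff.1 hcw)).symm⟩
  trans h h' := ⟨h.1.trans h'.1, fun a b hab hc =>
    (h.2 a b hab hc).trans (h'.2 a b hab fun c hcw => hc c (h.1.mem_iff.2 hcw))⟩
  append {u u' v v'} h h' := ⟨h.1.append h'.1, fun a b hab hc => by
    have h1 := h.2 a b hab fun c hcw => hc c (List.mem_append_left _ hcw)
    have h2 := h'.2 a b hab fun c hcw => hc c (List.mem_append_right _ hcw)
    rw [pair_sublist_append, pair_sublist_append, h1, h2, h.1.mem_iff, h'.1.mem_iff]⟩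
  perm h := h.1

/-- The plactic congruence, generated by Knuth's relations. -/
inductive Plactic : List α → List α → Prop
  | refl (u) : Plactic u u
  | symm {u v} : Plactic u v → Plactic v u
  | trans {u v w} : Plactic u v → Plactic v w → Plactic u w
  | knuth₁ (u v) {x y z} (hxy : x ≤ y) (hyz : y < z) :
      Plactic (u ++ [x, z, y] ++ v) (u ++ [z, x, y] ++ v)
  | knuth₂ (u v) {x y z} (hxy : x < y) (hyz : y ≤ z) :
      Plactic (u ++ [y, x, z] ++ v) (u ++ [y, z, x] ++ v)

theorem Plactic.context {w w' : List α} (h : Plactic w w') (s t : List α) :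
    Plactic (s ++ w ++ t) (s ++ w' ++ t) := by
  induction h with
  | refl => exact .refl _
  | symm _ ih => exact ih.symm
  | trans _ _ ih ih' => exact ih.trans ih'
  | knuth₁ u v hxy hyz => simpa using Plactic.knuth₁ (s ++ u) (v ++ t) hxy hyz
  | knuth₂ u v hxy hyz => simpa using Plactic.knuth₂ (s ++ u) (v ++ t) hxy hyz

theorem Plactic.append {u u' v v' : List α} (h : Plactic u u') (h' : Plactic v v') :
    Plactic (u ++ v) (u' ++ v') := by
  have h1 := h.context [] v
  have h2 := h'.context u' []
  simp only [List.nil_append, List.append_nil] at h1 h2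
  exact h1.trans h2

theorem Plactic.cons (a : α) {w w' : List α} (h : Plactic w w') :
    Plactic (a :: w) (a :: w') := by
  simpa using h.context [a] []

/-- In a Knuth relation the two exchanged letters are separated by the third one, so they are
neighbours in the alphabet of the word only if one of them equals the third letter. -/
theorem Plactic.hypoplactic {w w' : List α} (h : Plactic w w') : Hypoplactic w w' := by
  have C := Hypoplactic.isWordCongruence (α := α)
  induction h with
  | refl => exact C.refl _
  | symm _ ih => exact C.symm ih
  | trans _ _ ih ih' => exact C.trans ih ih'
  | knuth₁ u v hxy hyz =>
    refine C.append (C.append (C.refl u) ⟨.swap _ _ _, fun a b hab hc => ?_⟩) (C.refl v)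
    simp only [List.mem_cons, List.not_mem_nil, or_false, forall_eq_or_imp, forall_eq] at hc
    simp only [pair_sublist_cons, List.mem_cons, List.not_mem_nil, or_false]
    grind
  | knuth₂ u v hxy hyz =>
    refine C.append (C.append (C.refl u) ⟨.cons _ (.swap _ _ _), fun a b hab hc => ?_⟩) (C.refl v)
    simp only [List.mem_cons, List.not_mem_nil, or_false, forall_eq_or_imp, forall_eq] at hc
    simp only [pair_sublist_cons, List.mem_cons, List.not_mem_nil, or_false]
    grind

theorem Plactic.isWordCongruence : IsWordCongruence (Plactic (α := α)) where
  refl := .refl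
  symm := .symm
  trans := .trans
  append := .append
  perm h := h.hypoplactic.1

end Words

/-! ### String data structures from cross-sections of congruences -/

namespace StringData

variable {n : ℕ} {β : Type*} {S : StringData n β} {E : List (Fin n) → List (Fin n) → Prop}

theorem insRight_mem_and_read (hE : IsWordCongruence E)
    (hins : ∀ d ∈ S.carrier, ∀ x, S.ins d x ∈ S.carrier)
    (hread : ∀ d ∈ S.carrier, ∀ x, E (S.read (S.ins d x)) (S.read d ++ [x]))
    {d : β} (hd : d ∈ S.carrier) (u : List (Fin n)) :
    S.insRight d u ∈ S.carrier ∧ E (S.read (S.insRight d u)) (S.read d ++ u) := by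
  induction u generalizing d with
  | nil => simpa [insRight] using ⟨hd, hE.refl _⟩
  | cons x u ih =>
    obtain ⟨h1, h2⟩ := ih (hins d hd x)
    refine ⟨h1, hE.trans h2 ?_⟩
    simpa using hE.append (hread d hd x) (hE.refl u)

theorem insLeft_mem_and_read (hE : IsWordCongruence E)
    (hins : ∀ d ∈ S.carrier, ∀ x, S.ins d x ∈ S.carrier)
    (hread : ∀ d ∈ S.carrier, ∀ x, E (S.read (S.ins d x)) (x :: S.read d))
    {d : β} (hd : d ∈ S.carrier) (u : List (Fin n)) :
    S.insLeft u d ∈ S.carrier ∧ E (S.read (S.insLeft u d)) (u ++ S.read d) := by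
  induction u with
  | nil => simpa [insLeft] using ⟨hd, hE.refl _⟩
  | cons x u ih =>
    exact ⟨hins _ ih.1 x, hE.trans (hread _ ih.1 x) (hE.append (hE.refl [x]) ih.2)⟩

/-- A set whose readings form a cross-section of a congruence `E`, with an insertion that multiplies
the `E`-class of the reading by a letter on the right, is a right string data structure. -/
theorem isRight_of_crossSection (hE : IsWordCongruence E) (hempty : S.empty ∈ S.carrier)
    (hnil : S.read S.empty = []) (hins : ∀ d ∈ S.carrier, ∀ x, S.ins d x ∈ S.carrier)
    (hread : ∀ d ∈ S.carrier, ∀ x, E (S.read (S.ins d x)) (S.read d ++ [x]))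
    (hinj : ∀ d ∈ S.carrier, ∀ d' ∈ S.carrier, E (S.read d) (S.read d') → d = d') :
    S.IsRight where
  empty_mem := hempty
  ins_mem := hins
  read_letter x := by simpa [hnil] using hE.perm (hread _ hempty x)
  constr_read d hd := by
    obtain ⟨h1, h2⟩ := insRight_mem_and_read hE hins hread hempty (S.read d)
    exact hinj _ h1 _ hd (by simpa [hnil] using h2)
  read_injOn d hd d' hd' h := hinj d hd d' hd' (h ▸ hE.refl _)
  read_empty := hnil
  assoc d hd d' hd' d'' hd'' := by
    obtain ⟨m1, h1⟩ := insRight_mem_and_read hE hins hread hd (S.read d')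
    obtain ⟨m2, h2⟩ := insRight_mem_and_read hE hins hread m1 (S.read d'')
    obtain ⟨m3, h3⟩ := insRight_mem_and_read hE hins hread hd' (S.read d'')
    obtain ⟨m4, h4⟩ := insRight_mem_and_read hE hins hread hd (S.read (S.insRight d' (S.read d'')))
    refine hinj _ m2 _ m4 (hE.trans (hE.trans h2 (hE.append h1 (hE.refl _))) (hE.symm ?_))
    simpa using hE.trans h4 (hE.append (hE.refl _) h3)

/-- The mirror image of `isRight_of_crossSection`. -/
theorem isLeft_of_crossSection (hE : IsWordCongruence E) (hempty : S.empty ∈ S.carrier)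
    (hnil : S.read S.empty = []) (hins : ∀ d ∈ S.carrier, ∀ x, S.ins d x ∈ S.carrier)
    (hread : ∀ d ∈ S.carrier, ∀ x, E (S.read (S.ins d x)) (x :: S.read d))
    (hinj : ∀ d ∈ S.carrier, ∀ d' ∈ S.carrier, E (S.read d) (S.read d') → d = d') :
    S.IsLeft where
  empty_mem := hempty
  ins_mem := hins
  read_letter x := by simpa [hnil] using hE.perm (hread _ hempty x)
  constr_read d hd := by
    obtain ⟨h1, h2⟩ := insLeft_mem_and_read hE hins hread hempty (S.read d)
    exact hinj _ h1 _ hd (by simpa [hnil] using h2)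
  read_injOn d hd d' hd' h := hinj d hd d' hd' (h ▸ hE.refl _)
  read_empty := hnil
  assoc d hd d' hd' d'' hd'' := by
    obtain ⟨m1, h1⟩ := insLeft_mem_and_read hE hins hread hd (S.read d')
    obtain ⟨m2, h2⟩ := insLeft_mem_and_read hE hins hread m1 (S.read d'')
    obtain ⟨m3, h3⟩ := insLeft_mem_and_read hE hins hread hd' (S.read d'')
    obtain ⟨m4, h4⟩ := insLeft_mem_and_read hE hins hread hd (S.read (S.insLeft (S.read d'') d'))
    refine hinj _ m2 _ m4 (hE.trans (hE.trans h2 (hE.append (hE.refl _) h1)) (hE.symm ?_))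
    simpa using hE.trans h4 (hE.append h3 (hE.refl _))

end StringData

/-! ### Insertion by bumping in a list of lines -/

section Bump

variable {n : ℕ} {r : Fin n → Fin n → Bool} {x y : Fin n} {l m p : List (Fin n)}
  {L ls : List (List (Fin n))}

/-- The line `m` fits below (or on the right of) the line `l`: it is not longer than `l`, and
no entry of `m` is `r`-related to the entry of `l` in the same place. -/
def Dominates (r : Fin n → Fin n → Bool) : List (Fin n) → List (Fin n) → Prop
  | _, [] => True
  | [], _ :: _ => False
  | x :: l, y :: m => r y x = false ∧ Dominates r l m

theorem dominates_iff : Dominates r l m ↔ m.length ≤ l.length ∧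
    ∀ i : ℕ, ∀ a ∈ l[i]?, ∀ b ∈ m[i]?, r b a = false := by
  induction l generalizing m with
  | nil => cases m <;> simp [Dominates]
  | cons a l ih =>
    cases m with
    | nil => simp [Dominates]
    | cons b m =>
      rw [Dominates, ih]
      constructor
      · rintro ⟨h, hl, hi⟩
        refine ⟨by simpa using hl, fun i => ?_⟩
        cases i with
        | zero => simpa using h
        | succ i => simpa using hi i
      · rintro ⟨hl, hi⟩
        exact ⟨by simpa using hi 0, by simpa using hl, fun i => by simpa using hi (i + 1)⟩

/-- The lists of rows (for `r` the relation `≤`) or of columns (for `r` the relation `<`) of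
Young tableaux: each line is nonempty and sorted by `r`, and fits next to the preceding one. -/
def IsTableau (r : Fin n → Fin n → Bool) (L : List (List (Fin n))) : Prop :=
  (∀ l ∈ L, l ≠ [] ∧ l.Pairwise (fun a b => r a b)) ∧ L.IsChain (Dominates r)

theorem isTableau_nil : IsTableau r [] := ⟨by simp, by simp⟩

theorem isTableau_cons : IsTableau r (l :: ls) ↔
    (l ≠ [] ∧ l.Pairwise (fun a b => r a b) ∧ ∀ m ∈ ls.head?, Dominates r l m) ∧
      IsTableau r ls := by
  simp only [IsTableau, List.isChain_cons, List.mem_cons, forall_eq_or_imp]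
  tauto

/-- The transitivity conditions on `r` satisfied by both `<` and `≤` on a linear order. -/
structure IsBumpRelation (r : Fin n → Fin n → Bool) : Prop where
  trans : ∀ {a b c}, r a b → r b c → r a c
  negTrans : ∀ {a c}, r a c → ∀ b, r a b ∨ r b c

theorem isBumpRelation_lt : IsBumpRelation (fun a b : Fin n => decide (a < b)) where
  trans := by simpa using fun {a b c} (h : a < b) (h' : b < c) => h.trans h'
  negTrans := by
    intro a c h b
    simp only [decide_eq_true_eq] at *
    rcases lt_or_ge a b with h' | h'
    · exact .inl h'
    · exact .inr (h'.trans_lt h)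

theorem isBumpRelation_le : IsBumpRelation (fun a b : Fin n => decide (a ≤ b)) where
  trans := by simpa using fun {a b c} (h : a ≤ b) (h' : b ≤ c) => h.trans h'
  negTrans := by
    intro a c h b
    simp only [decide_eq_true_eq] at *
    rcases le_total a b with h' | h'
    · exact .inl h'
    · exact .inr (h'.trans h)

theorem bump_nil : bump r [] x = [[x]] := rfl

theorem bump_append (h : ∀ a ∈ l, r a x) : bump r (l :: ls) x = (l ++ [x]) :: ls := by
  rw [bump, List.dropWhile_eq_nil_iff.2 (by simpa using h)]

theorem bump_replace (h : ∀ a ∈ p, r a x) (hy : r y x = false) :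
    bump r ((p ++ y :: m) :: ls) x = (p ++ x :: m) :: bump r ls y := by
  rw [bump, List.dropWhile_append_of_pos (by simpa using h),
    List.takeWhile_append_of_pos (by simpa using h)]
  simp [hy]

/-- A line splits at the first entry that is not `r`-related to `x`, if there is one. -/
theorem forall_or_exists_split (r : Fin n → Fin n → Bool) (l : List (Fin n)) (x : Fin n) :
    (∀ a ∈ l, r a x) ∨ ∃ p y m, l = p ++ y :: m ∧ (∀ a ∈ p, r a x) ∧ r y x = false := by
  induction l with
  | nil => simp
  | cons a l ih =>
    cases ha : r a x with
    | false => exact .inr ⟨[], a, l, rfl, by simp, ha⟩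
    | true =>
      rcases ih with h | ⟨p, y, m, rfl, hp, hy⟩
      · exact .inl (by simpa [ha] using h)
      · exact .inr ⟨a :: p, y, m, rfl, by simpa [ha] using hp, hy⟩

theorem dominates_replace (hr : IsBumpRelation r) (hxy : r y x = false)
    (h : Dominates r (p ++ y :: l) m) : Dominates r (p ++ x :: l) m := by
  induction p generalizing m with
  | nil =>
    cases m with
    | nil => trivial
    | cons b m =>
      refine ⟨?_, h.2⟩
      by_contra hb
      rcases hr.negTrans (by simpa using hb : r b x) y with h' | h'
      · simp [h.1] at h'
      · simp [hxy] at h'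
  | cons a p ih =>
    cases m with
    | nil => trivial
    | cons b m => exact ⟨h.1, ih h.2⟩

/-- If `x` bumps `y` out of a line, then the insertion of `y` in the next line puts it weakly
before the place that it left. -/
theorem dominates_bump (hr : IsBumpRelation r) (hxy : r y x = false)
    (hp : ∀ a ∈ p, r a x) (h : Dominates r (p ++ y :: l) m) :
    ∃ m' t, bump r (m :: ls) y = m' :: t ∧ Dominates r (p ++ x :: l) m' := by
  induction p generalizing m with
  | nil =>
    cases m with
    | nil => exact ⟨[y], ls, bump_append (by simp), hxy, by cases l <;> trivial⟩
    | cons b m =>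
      exact ⟨y :: m, _, bump_replace (p := []) (by simp) h.1, hxy, h.2⟩
  | cons a p ih =>
    have hya : r y a = false := by
      by_contra h'
      simp [hr.trans (by simpa using h') (hp a (by simp))] at hxy
    cases m with
    | nil => exact ⟨[y], ls, bump_append (by simp), hya, by cases p <;> trivial⟩
    | cons b m =>
      cases hb : r b y with
      | false =>
        exact ⟨y :: m, _, bump_replace (p := []) (by simp) hb, hya, dominates_replace hr hxy h.2⟩
      | true =>
        obtain ⟨m', t, hm, hd⟩ := ih (fun c hc => hp c (by simp [hc])) h.2
        rcases forall_or_exists_split r m y with hall | ⟨q, z, s, rfl, hq, hz⟩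
        · rw [bump_append hall, List.cons.injEq] at hm
          refine ⟨b :: m', ls, ?_, h.1, hd⟩
          rw [bump_append (by simpa [hb] using hall), ← hm.1]; rfl
        · rw [bump_replace hq hz, List.cons.injEq] at hm
          refine ⟨b :: m', bump r ls z, ?_, h.1, hd⟩
          rw [← List.cons_append, bump_replace (by simpa [hb] using hq) hz, ← hm.1]; rfl

theorem dominates_append (h : Dominates r l m) : Dominates r (l ++ p) m := by
  induction l generalizing m with
  | nil => cases m <;> simp_all [Dominates]
  | cons a l ih =>
    cases m with
    | nil => trivial
    | cons b m => exact ⟨h.1, ih h.2⟩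

theorem IsTableau.bump (hr : IsBumpRelation r) (hL : IsTableau r L) (x : Fin n) :
    IsTableau r (bump r L x) := by
  induction L generalizing x with
  | nil => simp [bump_nil, isTableau_cons, isTableau_nil]
  | cons l ls ih =>
    rw [isTableau_cons] at hL
    obtain ⟨⟨hl, hs, hd⟩, hls⟩ := hL
    rcases forall_or_exists_split r l x with hall | ⟨p, y, m, rfl, hp, hy⟩
    · rw [bump_append hall, isTableau_cons]
      refine ⟨⟨by simp, ?_, fun m hm => dominates_append (hd m hm)⟩, hls⟩
      simpa [List.pairwise_append, hs] using hall
    · rw [bump_replace hp hy, isTableau_cons]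
      refine ⟨⟨by simp, ?_, ?_⟩, ih hls y⟩
      · simp only [List.pairwise_append, List.pairwise_cons, List.mem_cons] at hs ⊢
        refine ⟨hs.1, ⟨fun a ha => ?_, hs.2.1.2⟩, ?_⟩
        · rcases hr.negTrans (hs.2.1.1 a ha) x with h | h
          · simp [hy] at h
          · exact h
        · rintro a ha b (rfl | hb)
          · exact hp a ha
          · exact hs.2.2 a ha b (.inr hb)
      · cases ls with
        | nil =>
          obtain ⟨m', t, hm, hd⟩ := dominates_bump (m := []) (ls := []) hr hy hp
            (l := m) (by cases p <;> trivial)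
          rw [bump_append (by simp), List.cons.injEq] at hm
          simpa [bump_nil, ← hm.1] using hd
        | cons l' ls =>
          obtain ⟨m', t, hm, hd⟩ := dominates_bump (ls := ls) hr hy hp (hd l' rfl)
          simpa [hm] using hd

end Bump

/-! ### Exchange of rows and columns -/

section Transpose

variable {n : ℕ} {r s : Fin n → Fin n → Bool} {L L' : List (List (Fin n))}

/-- The `j`-th entry of the `i`-th line, if it exists. -/
def entry (L : List (List (Fin n))) (i j : ℕ) : Option (Fin n) := L[i]?.bind (·[j]?)

@[simp] theorem entry_nil (i j : ℕ) : entry ([] : List (List (Fin n))) i j = none := by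
  simp [entry]

@[simp] theorem entry_cons_zero (l : List (Fin n)) (j : ℕ) : entry (l :: L) 0 j = l[j]? := by
  simp [entry]

@[simp] theorem entry_cons_succ (l : List (Fin n)) (i j : ℕ) :
    entry (l :: L) (i + 1) j = entry L i j := by
  simp [entry]

/-- Lists of nonempty lines are determined by their entries. -/
theorem eq_of_entry_eq (hL : ∀ l ∈ L, l ≠ []) (hL' : ∀ l ∈ L', l ≠ [])
    (h : ∀ i j, entry L i j = entry L' i j) : L = L' := by
  induction L generalizing L' with
  | nil =>
    cases L' with
    | nil => rfl
    | cons l' L' =>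
      have := h 0 0
      simp [hL' l' (by simp)] at this
  | cons l L ih =>
    cases L' with
    | nil =>
      have := h 0 0
      simp [hL l (by simp)] at this
    | cons l' L' =>
      congr 1
      · exact List.ext_getElem? fun j => by simpa using h 0 j
      · exact ih (fun m hm => hL m (by simp [hm])) (fun m hm => hL' m (by simp [hm]))
          fun i j => by simpa using h (i + 1) j

/-- The description of tableaux by their entries, which treats the two indices alike. -/
theorem isTableau_iff_entry (hr : IsBumpRelation r) : IsTableau r L ↔ (∀ l ∈ L, l ≠ []) ∧
    (∀ i j b, entry L i (j + 1) = some b → ∃ a, entry L i j = some a ∧ r a b) ∧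
    (∀ i j b, entry L (i + 1) j = some b → ∃ a, entry L i j = some a ∧ r b a = false) := by
  have hpw (l : List (Fin n)) : l.Pairwise (fun a b => r a b) ↔
      ∀ (j : ℕ) (b : Fin n), l[j + 1]? = some b → ∃ a, l[j]? = some a ∧ r a b := by
    have : IsTrans (Fin n) (fun a b => r a b = true) := ⟨fun _ _ _ => hr.trans⟩
    rw [← List.isChain_iff_pairwise, List.isChain_iff_getElem]
    constructor
    · intro h j b hb
      obtain ⟨hj, rfl⟩ := List.getElem?_eq_some_iff.1 hb
      exact ⟨l[j], by simp, h j hj⟩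
    · intro h j hj
      obtain ⟨a, ha, hab⟩ := h j l[j + 1] (by simp)
      obtain ⟨_, rfl⟩ := List.getElem?_eq_some_iff.1 ha
      exact hab
  have hdom (l m : List (Fin n)) : Dominates r l m ↔
      ∀ (j : ℕ) (b : Fin n), m[j]? = some b → ∃ a, l[j]? = some a ∧ r b a = false := by
    rw [dominates_iff]
    constructor
    · rintro ⟨hl, h⟩ j b hb
      have hj := (List.getElem?_eq_some_iff.1 hb).1
      exact ⟨l[j], by simp, h j _ (by simp) b hb⟩
    · intro h
      constructor
      · by_contra! hl
        obtain ⟨a, ha, -⟩ := h l.length m[l.length] (by simp)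
        simp at ha
      · intro i a ha b hb
        obtain ⟨a', ha', hab⟩ := h i b hb
        rw [Option.mem_def, ha', Option.some_inj] at ha
        exact ha ▸ hab
  induction L with
  | nil => simp [isTableau_nil]
  | cons l ls ih =>
    rw [isTableau_cons, propext ih, hpw]
    simp only [List.mem_cons, forall_eq_or_imp]
    have hhead : (∀ m ∈ ls.head?, Dominates r l m) ↔
        ∀ j b, entry ls 0 j = some b → ∃ a, l[j]? = some a ∧ r b a = false := by
      cases ls with
      | nil => simp
      | cons m ls => simpa using hdom l m
    rw [hhead]
    constructor
    · rintro ⟨⟨h1, h2, h3⟩, h4, h5, h6⟩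
      refine ⟨⟨h1, h4⟩, fun i => ?_, fun i => ?_⟩
      · cases i with
        | zero => simpa using h2
        | succ i => simpa using h5 i
      · cases i with
        | zero => simpa using h3
        | succ i => simpa using h6 i
    · rintro ⟨⟨h1, h4⟩, h2, h3⟩
      exact ⟨⟨h1, by simpa using h2 0, by simpa using h3 0⟩, h4,
        fun i => by simpa using h2 (i + 1), fun i => by simpa using h3 (i + 1)⟩

theorem entry_isSome_of_le (h : ∀ i j b, entry L (i + 1) j = some b → ∃ a, entry L i j = some a)
    {i j : ℕ} {b : Fin n} (hb : entry L i j = some b) : ∃ a, entry L 0 j = some a := by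
  induction i generalizing b with
  | zero => exact ⟨b, hb⟩
  | succ i ih => obtain ⟨a, ha⟩ := h i j b hb; exact ih ha

theorem getElem?_filterMap_entry
    (h : ∀ i j b, entry L (i + 1) j = some b → ∃ a, entry L i j = some a) (i j : ℕ) :
    (L.filterMap (fun u => u[i]?))[j]? = entry L j i := by
  induction L generalizing j with
  | nil => simp
  | cons l L ih =>
    have h' : ∀ i j b, entry L (i + 1) j = some b → ∃ a, entry L i j = some a :=
      fun i j b hb => by simpa using h (i + 1) j b (by simpa using hb)
    cases hl : l[i]? with
    | some a =>
      rw [List.filterMap_cons_some (f := fun u : List (Fin n) => u[i]?) hl]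
      cases j with
      | zero => simp [hl]
      | succ j => simpa using ih h' j
    | none =>
      have hnone (k : ℕ) : entry (l :: L) k i = none := by
        by_contra hk
        obtain ⟨b, hb⟩ := Option.ne_none_iff_exists'.1 hk
        obtain ⟨a, ha⟩ := entry_isSome_of_le h hb
        simp [hl] at ha
      rw [List.filterMap_cons_none (f := fun u : List (Fin n) => u[i]?) hl, hnone, ih h' j]
      simpa using hnone (j + 1)

theorem length_le_foldr_max {u : List (Fin n)} (hu : u ∈ L) :
    u.length ≤ (L.map List.length).foldr max 0 := by
  induction L with
  | nil => simp at hu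
  | cons l L ih =>
    simp only [List.map_cons, List.foldr_cons]
    rcases List.mem_cons.1 hu with rfl | hu
    · exact le_max_left _ _
    · exact (ih hu).trans (le_max_right _ _)

theorem exists_length_of_lt_foldr_max {i : ℕ} (hi : i < (L.map List.length).foldr max 0) :
    ∃ u ∈ L, i < u.length := by
  induction L with
  | nil => simp at hi
  | cons l L ih =>
    simp only [List.map_cons, List.foldr_cons, lt_max_iff] at hi
    rcases hi with hi | hi
    · exact ⟨l, by simp, hi⟩
    · obtain ⟨u, hu, h⟩ := ih hi
      exact ⟨u, by simp [hu], h⟩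

theorem entry_transpose
    (h : ∀ i j b, entry L (i + 1) j = some b → ∃ a, entry L i j = some a) (i j : ℕ) :
    entry (transpose L) i j = entry L j i := by
  by_cases hi : i < (L.map List.length).foldr max 0
  · rw [← getElem?_filterMap_entry h, entry, transpose]
    simp [hi]
  · have : entry L j i = none := by
      by_contra hk
      obtain ⟨b, hb⟩ := Option.ne_none_iff_exists'.1 hk
      obtain ⟨u, hu, hub⟩ := Option.bind_eq_some_iff.1 hb
      exact hi (((List.getElem?_eq_some_iff.1 hub).1).trans_le
        (length_le_foldr_max (List.mem_of_getElem? hu)))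
    rw [this, entry, transpose, List.getElem?_eq_none (by simpa using hi)]
    rfl

theorem transpose_ne_nil {l : List (Fin n)} (hl : l ∈ transpose L) : l ≠ [] := by
  obtain ⟨i, hi, rfl⟩ := List.mem_map.1 hl
  obtain ⟨u, hu, h⟩ := exists_length_of_lt_foldr_max (List.mem_range.1 hi)
  intro h0
  rw [List.filterMap_eq_nil_iff] at h0
  simpa [h] using h0 u hu

theorem IsTableau.entry_isSome (hr : IsBumpRelation r) (hL : IsTableau r L) :
    ∀ i j b, entry L (i + 1) j = some b → ∃ a, entry L i j = some a := fun i j b hb =>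
  let ⟨a, ha, _⟩ := ((isTableau_iff_entry hr).1 hL).2.2 i j b hb
  ⟨a, ha⟩

/-- The rows of a tableau are weakly increasing and its columns strictly: exchanging them replaces
`r` by the negation of its converse. -/
theorem IsTableau.transpose (hr : IsBumpRelation r) (hs : IsBumpRelation s)
    (hrs : ∀ a b, s a b = !r b a) (hL : IsTableau r L) :
    IsTableau s (transpose L) := by
  have h := (isTableau_iff_entry hr).1 hL
  rw [isTableau_iff_entry hs]
  simp only [entry_transpose (hL.entry_isSome hr), hrs]
  refine ⟨fun l => transpose_ne_nil, fun i j b hb => ?_, fun i j b hb => ?_⟩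
  · simpa using h.2.2 j i b hb
  · simpa using h.2.1 j i b hb

theorem IsTableau.transpose_transpose (hr : IsBumpRelation r) (hs : IsBumpRelation s)
    (hrs : ∀ a b, s a b = !r b a) (hL : IsTableau r L) :
    StringColumns.transpose (StringColumns.transpose L) = L :=
  eq_of_entry_eq (fun _ => transpose_ne_nil) (fun l hl => (hL.1 l hl).1) fun i j => by
    rw [entry_transpose ((hL.transpose hr hs hrs).entry_isSome hs),
      entry_transpose (hL.entry_isSome hr)]

end Transpose

/-! ### Readings of tableaux in the plactic monoid -/

section PlacticMoves

variable {α : Type*} [LinearOrder α] {x y : α} {l : List α}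

theorem Plactic.move_right_before (hxy : x ≤ y) (hl : (l ++ [y]).Pairwise (· > ·)) :
    Plactic (x :: (l ++ [y])) (l ++ [x, y]) := by
  induction l with
  | nil => exact .refl _
  | cons d l ih =>
    rw [List.cons_append, List.pairwise_cons] at hl
    refine .trans ?_ ((ih hl.2).cons d)
    cases l with
    | nil => simpa using Plactic.knuth₁ [] [] hxy (hl.1 y (by simp))
    | cons e l =>
      have hye : y < e := by simpa using (List.pairwise_cons.1 hl.2).1 y (by simp)
      simpa using Plactic.knuth₁ [] (l ++ [y]) (hxy.trans hye.le) (hl.1 e (by simp))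

theorem Plactic.move_right_after (hxy : x ≤ y) (hl : (x :: l).Pairwise (· > ·)) :
    Plactic (x :: y :: l) (x :: (l ++ [y])) := by
  induction l generalizing x with
  | nil => exact .refl _
  | cons d l ih =>
    rw [List.pairwise_cons] at hl
    have hd : d < x := hl.1 d (by simp)
    have h := (Plactic.knuth₂ [] l hd hxy).symm
    exact h.trans ((ih (hd.le.trans hxy) hl.2).cons x)

theorem Plactic.move_left_after (hxy : x < y) (hl : (y :: l).Pairwise (· ≤ ·)) :
    Plactic (y :: (l ++ [x])) (y :: x :: l) := by
  induction l generalizing y with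
  | nil => exact .refl _
  | cons d l ih =>
    rw [List.pairwise_cons] at hl
    have hd : y ≤ d := hl.1 d (by simp)
    exact ((ih (hxy.trans_le hd) hl.2).cons y).trans (Plactic.knuth₂ [] l hxy hd).symm

theorem Plactic.move_left_before (hxy : x < y) (hl : (l ++ [x]).Pairwise (· ≤ ·)) :
    Plactic (l ++ [y, x]) (y :: (l ++ [x])) := by
  induction l with
  | nil => exact .refl _
  | cons d l ih =>
    rw [List.cons_append, List.pairwise_cons] at hl
    refine ((ih hl.2).cons d).trans ?_
    cases l with
    | nil => simpa using Plactic.knuth₁ [] [] (hl.1 x (by simp)) hxy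
    | cons e l =>
      have hex : e ≤ x := by simpa using (List.pairwise_cons.1 hl.2).1 x (by simp)
      simpa using Plactic.knuth₁ [] (l ++ [x]) (hl.1 e (by simp)) (hex.trans_lt hxy)

/-- Schensted's bumping of `y` by `x` in a column, on the bottom to top readings. -/
theorem Plactic.bump_column {p q : List α} (hxy : x ≤ y)
    (hs : (p ++ y :: q).Pairwise (· < ·)) (hp : ∀ a ∈ p, a < x) :
    Plactic (x :: (p ++ y :: q).reverse) ((p ++ x :: q).reverse ++ [y]) := by
  have hs' : (p ++ y :: q).reverse.Pairwise (· > ·) := List.pairwise_reverse.2 hs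
  simp only [List.reverse_append, List.reverse_cons] at hs' ⊢
  have h1 := move_right_before hxy (List.pairwise_append.1 hs').1
  have h2 : (x :: p.reverse).Pairwise (· > ·) :=
    List.pairwise_cons.2 ⟨by simpa using hp, (List.pairwise_append.1 hs').2.1⟩
  have h3 := (Plactic.refl q.reverse).append (move_right_after hxy h2)
  have h4 := h1.append (Plactic.refl p.reverse)
  simp only [List.append_assoc, List.cons_append, List.nil_append] at h3 h4 ⊢
  exact h4.trans h3

/-- Schensted's bumping of `y` by `x` in a row, on the left to right readings. -/
theorem Plactic.bump_row {p q : List α} (hxy : x < y)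
    (hs : (p ++ y :: q).Pairwise (· ≤ ·)) (hp : ∀ a ∈ p, a ≤ x) :
    Plactic (p ++ y :: q ++ [x]) (y :: (p ++ x :: q)) := by
  have hs' := List.pairwise_append.1 hs
  have h1 := (Plactic.refl p).append (move_left_after hxy hs'.2.1)
  have h2 : (p ++ [x]).Pairwise (· ≤ ·) := by
    simpa [List.pairwise_append, hs'.1] using hp
  have h3 := (move_left_before hxy h2).append (Plactic.refl q)
  simp only [List.append_assoc, List.cons_append, List.nil_append] at h1 h3 ⊢
  exact h1.trans h3

/-- A strictly decreasing word can be moved across the entries, other than the first one, of a row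
whose first entry is larger. -/
theorem Plactic.move_decreasing_left {w : List α} (hl : (x :: l).Pairwise (· ≤ ·))
    (hw : (x :: w).Pairwise (· > ·)) : Plactic (x :: (l ++ w)) (x :: (w ++ l)) := by
  induction w generalizing x with
  | nil => simpa using Plactic.refl (x :: l)
  | cons a w ih =>
    rw [List.pairwise_cons] at hl hw
    have hax : a < x := hw.1 a (by simp)
    have h1 := (move_left_after hax (List.pairwise_cons.2 hl)).append (Plactic.refl w)
    have h2 := (ih (x := a)
      (List.pairwise_cons.2 ⟨fun b hb => hax.le.trans (hl.1 b hb), hl.2⟩) hw.2).cons x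
    simp only [List.append_assoc, List.cons_append, List.nil_append] at h1 h2 ⊢
    exact h1.trans h2

end PlacticMoves

section Readings

variable {n : ℕ} {L : List (List (Fin n))}

/-- The reading of a list of columns from left to right, each from bottom to top. -/
def columnReading (L : List (List (Fin n))) : List (Fin n) := L.flatMap List.reverse

/-- The reading of a list of rows from bottom to top, each from left to right. -/
def rowReading (L : List (List (Fin n))) : List (Fin n) := L.reverse.flatten

@[simp] theorem columnReading_nil : columnReading ([] : List (List (Fin n))) = [] := rfl

@[simp] theorem columnReading_cons (l : List (Fin n)) :
    columnReading (l :: L) = l.reverse ++ columnReading L := by simp [columnReading]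

@[simp] theorem columnReading_append (L' : List (List (Fin n))) :
    columnReading (L ++ L') = columnReading L ++ columnReading L' := by simp [columnReading]

@[simp] theorem rowReading_nil : rowReading ([] : List (List (Fin n))) = [] := rfl

@[simp] theorem rowReading_cons (l : List (Fin n)) :
    rowReading (l :: L) = rowReading L ++ l := by simp [rowReading]

@[simp] theorem rowReading_append (L' : List (List (Fin n))) :
    rowReading (L ++ L') = rowReading L' ++ rowReading L := by simp [rowReading]

theorem plactic_columnReading_bump (hL : IsTableau (fun a b => decide (a < b)) L) (x : Fin n) :
    Plactic (columnReading (bump (fun a b => decide (a < b)) L x)) (x :: columnReading L) := by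
  induction L generalizing x with
  | nil => simpa [bump_nil] using Plactic.refl [x]
  | cons l ls ih =>
    rw [isTableau_cons] at hL
    rcases forall_or_exists_split (fun a b => decide (a < b)) l x with h | ⟨p, y, m, rfl, hp, hy⟩
    · rw [bump_append h]
      simpa using Plactic.refl _
    · rw [bump_replace hp hy, columnReading_cons, columnReading_cons]
      have h1 := ((Plactic.refl _).append (ih hL.2 y) : Plactic ((p ++ x :: m).reverse ++ _) _)
      have h2 := (Plactic.bump_column (by simpa using hy) (by simpa using hL.1.2.1)
        (by simpa using hp)).append (Plactic.refl (columnReading ls))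
      refine h1.trans (.trans ?_ h2.symm)
      simpa using Plactic.refl _

theorem plactic_rowReading_bump (hL : IsTableau (fun a b => decide (a ≤ b)) L) (x : Fin n) :
    Plactic (rowReading (bump (fun a b => decide (a ≤ b)) L x)) (rowReading L ++ [x]) := by
  induction L generalizing x with
  | nil => simpa [bump_nil] using Plactic.refl [x]
  | cons l ls ih =>
    rw [isTableau_cons] at hL
    rcases forall_or_exists_split (fun a b => decide (a ≤ b)) l x with h | ⟨p, y, m, rfl, hp, hy⟩
    · rw [bump_append h]
      simpa using Plactic.refl _
    · rw [bump_replace hp hy, rowReading_cons, rowReading_cons]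
      have h1 := (ih hL.2 y).append (Plactic.refl (p ++ x :: m))
      have h2 := (Plactic.refl (rowReading ls)).append (Plactic.bump_row (by simpa using hy)
        (by simpa using hL.1.2.1) (by simpa using hp))
      refine h1.trans (.trans ?_ (h2.symm.trans ?_))
      · simpa using Plactic.refl _
      · simpa using Plactic.refl _

/-- Adds a column on the left of a list of rows. The column must have at least as many boxes as
there are rows: the rows in excess are dropped. -/
def addColumn : List (Fin n) → List (List (Fin n)) → List (List (Fin n))
  | [], _ => []
  | a :: c, [] => [a] :: addColumn c []
  | a :: c, r :: R => (a :: r) :: addColumn c R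

theorem entry_addColumn_zero (u : List (Fin n)) (R : List (List (Fin n))) (i : ℕ) :
    entry (addColumn u R) i 0 = u[i]? := by
  induction u generalizing R i with
  | nil => simp [addColumn]
  | cons a c ih => cases R <;> cases i <;> simp [addColumn, ih]

theorem entry_addColumn_succ (c : List (Fin n)) (R : List (List (Fin n)))
    (h : R.length ≤ c.length) (i j : ℕ) :
    entry (addColumn c R) i (j + 1) = entry R i j := by
  induction c generalizing R i with
  | nil => simp_all [addColumn]
  | cons a c ih =>
    cases R with
    | nil => cases i <;> simp [addColumn, ih]
    | cons r R => cases i <;> simp_all [addColumn]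

theorem addColumn_ne_nil {c : List (Fin n)} {R : List (List (Fin n))} {l : List (Fin n)}
    (hl : l ∈ addColumn c R) : l ≠ [] := by
  induction c generalizing R with
  | nil => simp [addColumn] at hl
  | cons a c ih =>
    cases R <;> rw [addColumn, List.mem_cons] at hl <;>
      rcases hl with rfl | hl <;> first | exact List.cons_ne_nil _ _ | exact ih hl

/-- Exchanges the column of heads with the word `w`, on the way from the row reading to the column
reading of a tableau with first column `c`. -/
theorem plactic_rowReading_addColumn {c w : List (Fin n)} {R : List (List (Fin n))}
    (hR : R.length ≤ c.length) (hrow : ∀ l ∈ addColumn c R, l.Pairwise (· ≤ ·))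
    (hw : (c.reverse ++ w).Pairwise (· > ·)) :
    Plactic (rowReading (addColumn c R) ++ w) (c.reverse ++ w ++ rowReading R) := by
  induction c generalizing R w with
  | nil => simp_all [addColumn, Plactic.refl]
  | cons a c ih =>
    have key (r : List (Fin n)) (R' : List (List (Fin n))) (hR' : R'.length ≤ c.length)
        (hrow' : ∀ l ∈ (a :: r) :: addColumn c R', l.Pairwise (· ≤ ·)) :
        Plactic (rowReading ((a :: r) :: addColumn c R') ++ w)
          ((a :: c).reverse ++ w ++ (rowReading R' ++ r)) := by
      simp only [List.mem_cons, forall_eq_or_imp] at hrow'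
      simp only [List.reverse_cons, List.append_assoc, List.singleton_append] at hw
      have h1 := (Plactic.refl (rowReading (addColumn c R'))).append
        (Plactic.move_decreasing_left hrow'.1 (List.pairwise_append.1 hw).2.1)
      have h2 := (ih hR' hrow'.2 hw).append (Plactic.refl r)
      simp only [List.append_assoc, List.cons_append, List.nil_append, rowReading_cons,
        List.reverse_cons] at h1 h2 ⊢
      exact h1.trans h2
    cases R with
    | nil => simpa [addColumn] using key [] [] (by simp) hrow
    | cons r R => simpa [addColumn] using key r R (by simpa using hR) hrow

theorem plactic_rowReading_transpose (hL : IsTableau (fun a b => decide (a < b)) L) :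
    Plactic (rowReading (transpose L)) (columnReading L) := by
  have hrs : ∀ a b : Fin n, decide (a ≤ b) = !decide (b < a) := fun a b => by
    rw [← decide_not, decide_eq_decide, not_lt]
  induction L with
  | nil => exact .refl _
  | cons c L ih =>
    have hT := hL.transpose isBumpRelation_lt isBumpRelation_le hrs
    have hL' := (isTableau_cons.1 hL).2
    have hlen : (transpose L).length ≤ c.length := by
      by_contra! hlt
      have h0 : entry (transpose L) c.length 0 ≠ none := by
        have := transpose_ne_nil (List.getElem_mem hlt)
        simpa [entry, hlt, List.length_pos_iff] using this
      obtain ⟨b, hb⟩ := Option.ne_none_iff_exists'.1 h0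
      rw [entry_transpose (hL'.entry_isSome isBumpRelation_lt)] at hb
      obtain ⟨a, ha⟩ := hL.entry_isSome isBumpRelation_lt 0 c.length b (by simpa using hb)
      simp at ha
    have heq : transpose (c :: L) = addColumn c (transpose L) := by
      refine eq_of_entry_eq (fun _ => transpose_ne_nil) (fun _ => addColumn_ne_nil) fun i j => ?_
      rw [entry_transpose (hL.entry_isSome isBumpRelation_lt)]
      cases j with
      | zero => rw [entry_addColumn_zero, entry_cons_zero]
      | succ j => rw [entry_addColumn_succ _ _ hlen, entry_cons_succ,
          entry_transpose (hL'.entry_isSome isBumpRelation_lt)]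
    rw [heq] at hT ⊢
    have h := plactic_rowReading_addColumn (w := []) hlen
      (fun l hl => by simpa using (hT.1 l hl).2)
      (by simpa [List.pairwise_reverse] using (isTableau_cons.1 hL).1.2.1)
    simp only [List.append_nil, columnReading_cons] at h ⊢
    exact h.trans ((Plactic.refl _).append (ih hL'))

end Readings

/-! ### Young tableaux as a cross-section of the plactic congruence -/

section ColumnInsertion

variable {n : ℕ} {x y z : Fin n} {l p q : List (Fin n)} {L : List (List (Fin n))}

/-- Column insertion in a list of columns. -/
abbrev columnBump (L : List (List (Fin n))) (x : Fin n) : List (List (Fin n)) :=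
  bump (fun a b => decide (a < b)) L x

theorem columnBump_append (h : ∀ a ∈ l, a < x) : columnBump (l :: L) x = (l ++ [x]) :: L :=
  bump_append (by simpa using h)

theorem columnBump_replace (h : ∀ a ∈ p, a < x) (hy : x ≤ y) :
    columnBump ((p ++ y :: q) :: L) x = (p ++ x :: q) :: columnBump L y :=
  bump_replace (by simpa using h) (by simpa using hy)

theorem columnBump_nil (x : Fin n) : columnBump [] x = columnBump [[]] x := rfl

theorem forall_lt_or_exists_split (l : List (Fin n)) (x : Fin n) :
    (∀ a ∈ l, a < x) ∨ ∃ p y q, l = p ++ y :: q ∧ (∀ a ∈ p, a < x) ∧ x ≤ y := by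
  simpa using forall_or_exists_split (fun a b => decide (a < b)) l x

/-- The columns of a list strictly increase. -/
def HasColumns (L : List (List (Fin n))) : Prop := ∀ l ∈ L, l.Pairwise (· < ·)

theorem hasColumns_cons : HasColumns (l :: L) ↔ l.Pairwise (· < ·) ∧ HasColumns L := by
  simp [HasColumns]

theorem HasColumns.columnBump (hL : HasColumns L) (x : Fin n) :
    HasColumns (columnBump L x) := by
  induction L generalizing x with
  | nil => simp [HasColumns, bump_nil]
  | cons l L ih =>
    rw [hasColumns_cons] at hL
    rcases forall_lt_or_exists_split l x with h | ⟨p, y, q, rfl, hp, hy⟩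
    · rw [columnBump_append h, hasColumns_cons]
      exact ⟨by simpa [List.pairwise_append, hL.1] using h, hL.2⟩
    · rw [columnBump_replace hp hy, hasColumns_cons]
      refine ⟨?_, ih hL.2 y⟩
      have := hL.1
      simp only [List.pairwise_append, List.pairwise_cons, List.mem_cons] at this ⊢
      grind

theorem lt_of_mem_right (h : (p ++ y :: q).Pairwise (· < ·)) : ∀ a ∈ q, y < a :=
  (List.pairwise_cons.1 (List.pairwise_append.1 h).2.1).1

/-- The insertions of the two sides of a Knuth relation `xzy ∼ zxy` in a column give the same
column; they bump words that are equal or in a Knuth relation of the same kind. -/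
theorem columnBump_knuth₁ (hL : HasColumns L) (hxy : x ≤ y) (hyz : y < z) :
    columnBump (columnBump (columnBump L y) z) x =
      columnBump (columnBump (columnBump L y) x) z := by
  induction L generalizing x y z with
  | nil =>
    rw [columnBump_nil, columnBump_append (by simp)]
    have e1 : columnBump [[] ++ [y]] z = [[] ++ y :: [z]] := columnBump_append (by simpa using hyz)
    have e2 : columnBump [[] ++ [y]] x = ([] ++ x :: []) :: columnBump [] y :=
      columnBump_replace (by simp) hxy
    rw [e1, e2, columnBump_replace (by simp) hxy,
      columnBump_append (by simpa using hxy.trans_lt hyz)]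
    rfl
  | cons l L ih =>
    rw [hasColumns_cons] at hL
    obtain ⟨hl, hL⟩ := hL
    rcases forall_lt_or_exists_split l y with h | ⟨p, o, q, rfl, hp, ho⟩
    · rw [columnBump_append h]
      have hz : ∀ a ∈ l ++ [y], a < z := by clear ih; grind
      obtain h' | ⟨p, e, q, hl', hp, he⟩ := forall_lt_or_exists_split (l ++ [y]) x
      · exact absurd (h' y (by simp)) (not_lt.2 hxy)
      · rw [columnBump_append hz, hl', List.append_assoc, List.cons_append,
          columnBump_replace hp he, columnBump_replace hp he,
          columnBump_append (by clear ih; grind)]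
        simp
    · rw [columnBump_replace hp ho]
      have hq : ∀ a ∈ q, o < a := lt_of_mem_right hl
      clear hl
      obtain h' | ⟨p₁, e, p₂, hl', hp₁, he⟩ := forall_lt_or_exists_split (p ++ [y]) x
      · exact absurd (h' y (by simp)) (not_lt.2 hxy)
      · have hey : e ≤ y := by
          have : e ∈ p ++ [y] := by simp [hl']
          clear ih; grind
        have hlz : ∀ a ∈ p₁ ++ x :: p₂, a < z := by
          intro a ha
          have : a ∈ p ++ [y] ∨ a = x := by rw [hl']; clear ih; grind
          clear ih; grind
        have hlz' : ∀ a ∈ p₁ ++ e :: p₂, a < z := by rw [← hl']; clear ih; grind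
        have e1 : p ++ y :: q = p₁ ++ e :: (p₂ ++ q) := by
          simpa using congrArg (· ++ q) hl'
        rcases forall_lt_or_exists_split q z with h | ⟨q₁, f, q₂, rfl, hq₁, hf⟩
        · have h1 : ∀ a ∈ p₁ ++ e :: (p₂ ++ q), a < z := by clear ih; grind
          have h2 : ∀ a ∈ p₁ ++ x :: (p₂ ++ q), a < z := by clear ih; grind
          rw [e1, columnBump_append h1, columnBump_replace hp₁ he, columnBump_append h2,
            List.append_assoc, List.cons_append, columnBump_replace hp₁ he]
          simp
        · have e2 : p₁ ++ e :: (p₂ ++ (q₁ ++ f :: q₂)) = (p₁ ++ e :: (p₂ ++ q₁)) ++ f :: q₂ := by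
            simp
          have e3 : p₁ ++ x :: (p₂ ++ (q₁ ++ f :: q₂)) = (p₁ ++ x :: (p₂ ++ q₁)) ++ f :: q₂ := by
            simp
          have e4 : (p₁ ++ e :: (p₂ ++ q₁)) ++ z :: q₂ = p₁ ++ e :: (p₂ ++ q₁ ++ z :: q₂) := by
            simp
          rw [e1, columnBump_replace hp₁ he, e2, e3, columnBump_replace (by clear ih; grind) hf,
            columnBump_replace (by clear ih; grind) hf, e4, columnBump_replace hp₁ he,
            ih hL (hey.trans ho) (hq f (by simp))]
          simp

/-- The insertions of the two sides of a Knuth relation `yxz ∼ yzx` in a column give the same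
column; they bump words that are equal or in a Knuth relation. -/
theorem columnBump_knuth₂ (hL : HasColumns L) (hxy : x < y) (hyz : y ≤ z) :
    columnBump (columnBump (columnBump L z) x) y =
      columnBump (columnBump (columnBump L x) z) y := by
  induction L generalizing x y z with
  | nil =>
    have e1 : columnBump [[z]] x = [[x], [z]] :=
      columnBump_replace (p := []) (by simp) (hxy.le.trans hyz)
    have e2 : columnBump [[x], [z]] y = [[x, y], [z]] :=
      columnBump_append (l := [x]) (by simpa using hxy)
    have e3 : columnBump [[x]] z = [[x, z]] :=
      columnBump_append (l := [x]) (by simpa using hxy.trans_le hyz)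
    have e4 : columnBump [[x, z]] y = [[x, y], [z]] :=
      columnBump_replace (p := [x]) (by simpa using hxy) hyz
    simp only [show ∀ w : Fin n, columnBump [] w = [[w]] from fun _ => rfl, e1, e2, e3, e4]
  | cons l L ih =>
    rw [hasColumns_cons] at hL
    obtain ⟨hl, hL⟩ := hL
    have hxz := hxy.trans_le hyz
    obtain h | ⟨p, e, q, rfl, hp, he⟩ := forall_lt_or_exists_split l x
    · rw [columnBump_append h, columnBump_append (fun a ha => (h a ha).trans hxz),
        columnBump_replace h hxz.le, columnBump_append (by clear ih; grind),
        columnBump_append (by clear ih; grind), columnBump_replace (by clear ih; grind) hyz]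
    · rw [columnBump_replace hp he]
      have hq : ∀ a ∈ q, e < a := lt_of_mem_right hl
      clear hl
      rcases le_or_gt z e with hze | hez
      · -- Both `x` and `z` compete for the entry `e`.
        rw [columnBump_replace (fun a ha => (hp a ha).trans hxz) hze, columnBump_replace hp hxz.le]
        have e1 : p ++ x :: q = (p ++ [x]) ++ q := by simp
        have hpx : ∀ a ∈ p ++ [x], a < y := by clear ih; grind
        cases q with
        | nil =>
          rw [columnBump_append (by clear ih; grind), columnBump_append (by clear ih; grind)]
          exact (columnBump_replace hpx hyz).symm
        | cons f q =>
          have hef := hq f (by simp)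
          rw [e1, columnBump_replace hpx (by clear ih; grind),
            columnBump_replace (by clear ih; grind) (by clear ih; grind),
            columnBump_replace hpx hyz, columnBump_knuth₁ hL hze hef]
      · -- Otherwise they do not interact.
        rcases forall_lt_or_exists_split q z with h | ⟨q₁, f, q₂, rfl, hq₁, hf⟩
        · have h1 : ∀ a ∈ p ++ e :: q, a < z := by clear ih; grind
          have h2 : ∀ a ∈ p ++ x :: q, a < z := by clear ih; grind
          rw [columnBump_append h1, columnBump_append h2, List.append_assoc,
            List.cons_append, columnBump_replace hp he]
          simp
        · have e1 : p ++ e :: (q₁ ++ f :: q₂) = (p ++ e :: q₁) ++ f :: q₂ := by simp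
          have e2 : (p ++ e :: q₁) ++ z :: q₂ = p ++ e :: (q₁ ++ z :: q₂) := by simp
          have e3 : p ++ x :: (q₁ ++ f :: q₂) = (p ++ x :: q₁) ++ f :: q₂ := by simp
          rw [e1, columnBump_replace (by clear ih; grind) hf, e2, columnBump_replace hp he, e3,
            columnBump_replace (by clear ih; grind) hf]
          -- The third letter bumps an entry `g` of the column between `e` and `f`.
          obtain h' | ⟨s, g, t, hs, hs', hg⟩ := forall_lt_or_exists_split (q₁ ++ [z]) y
          · exact absurd (h' z (by simp)) (not_lt.2 hyz)
          · have hgm : g ∈ q₁ ∨ g = z := by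
              have : g ∈ q₁ ++ [z] := by simp [hs]
              simpa using this
            have e4 : p ++ x :: (q₁ ++ z :: q₂) = (p ++ x :: s) ++ g :: (t ++ q₂) := by
              simpa using congrArg (fun w => p ++ x :: (w ++ q₂)) hs
            have e5 : (p ++ x :: q₁) ++ z :: q₂ = (p ++ x :: s) ++ g :: (t ++ q₂) := by
              simpa using e4
            rw [e4, e5, columnBump_replace (by clear ih; grind) hg,
              columnBump_replace (by clear ih; grind) hg,
              ih hL (by clear ih; grind) (by clear ih; grind)]

theorem foldr_columnBump_congr {u v : List (Fin n)} (h : Plactic u v) (hL : HasColumns L) :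
    u.foldr (fun x e => columnBump e x) L = v.foldr (fun x e => columnBump e x) L := by
  have hcol (w : List (Fin n)) : HasColumns (w.foldr (fun x e => columnBump e x) L) := by
    induction w with
    | nil => exact hL
    | cons x w ih => exact ih.columnBump x
  induction h with
  | refl => rfl
  | symm _ ih => exact ih.symm
  | trans _ _ ih ih' => exact ih.trans ih'
  | knuth₁ u v hxy hyz =>
    simp only [List.foldr_append, List.foldr_cons, List.foldr_nil]
    rw [columnBump_knuth₁ (hcol v) hxy hyz]
  | knuth₂ u v hxy hyz =>
    simp only [List.foldr_append, List.foldr_cons, List.foldr_nil]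
    rw [columnBump_knuth₂ (hcol v) hxy hyz]

/-- The insertion, from top to bottom, of the part `s` of a column below `p` pushes the
corresponding entries of the next column to the right. -/
theorem foldl_columnBump_column {s t : List (Fin n)} (hs : (p ++ s).Pairwise (· < ·))
    (hst : Dominates (fun a b => decide (a < b)) s t) :
    s.foldl columnBump ((p ++ t) :: L) = (p ++ s) :: t.foldl columnBump L := by
  induction s generalizing p t L with
  | nil => cases t <;> simp_all [Dominates]
  | cons a s ih =>
    have hp : ∀ b ∈ p, b < a := by grind
    have hs' : (p ++ [a] ++ s).Pairwise (· < ·) := by simpa using hs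
    cases t with
    | nil =>
      have h := ih (t := []) (L := L) hs' (by cases s <;> trivial)
      rw [List.foldl_cons, List.append_nil, columnBump_append hp]
      simpa using h
    | cons b t =>
      have h := ih (L := columnBump L b) hs' hst.2
      rw [List.foldl_cons, columnBump_replace hp (by simpa using hst.1)]
      simpa using h

theorem foldl_columnBump_of_isTableau (hL : IsTableau (fun a b => decide (a < b)) (l :: L)) :
    l.foldl columnBump L = l :: L := by
  induction L generalizing l with
  | nil =>
    obtain ⟨hl, hs, -⟩ := (isTableau_cons.1 hL).1
    have h := foldl_columnBump_column (L := []) (p := []) (s := l) (t := []) (by simpa using hs)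
      (by cases l <;> trivial)
    cases l with
    | nil => exact absurd rfl hl
    | cons a l => simpa [columnBump_nil] using h
  | cons m L ih =>
    obtain ⟨⟨-, hs, hd⟩, hL⟩ := isTableau_cons.1 hL
    have h := foldl_columnBump_column (L := L) (p := []) (by simpa using hs) (hd m rfl)
    rw [ih hL] at h
    exact h

/-- A tableau is recovered by the column insertion of its reading. -/
theorem foldr_columnBump_columnReading (hL : IsTableau (fun a b => decide (a < b)) L) :
    (columnReading L).foldr (fun x e => columnBump e x) [] = L := by
  induction L with
  | nil => rfl
  | cons c L ih =>
    rw [columnReading_cons, List.foldr_append, ih (isTableau_cons.1 hL).2, List.foldr_reverse]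
    exact foldl_columnBump_of_isTableau hL

theorem IsTableau.eq_of_plactic {L' : List (List (Fin n))}
    (hL : IsTableau (fun a b => decide (a < b)) L)
    (hL' : IsTableau (fun a b => decide (a < b)) L')
    (h : Plactic (columnReading L) (columnReading L')) : L = L' := by
  rw [← foldr_columnBump_columnReading hL, ← foldr_columnBump_columnReading hL']
  exact foldr_columnBump_congr h (by simp [HasColumns])

end ColumnInsertion

/-! ### Ribbons, their rows and their columns -/

section Ribbons

variable {n : ℕ} {r s : Fin n → Fin n → Bool} {a x : Fin n} {l : List (Fin n)}
  {L ls : List (List (Fin n))}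

/-- The lists of columns (for `r` the relation `<`) or of rows (for `r` the relation `≤`) of
quasi-ribbon tableaux. The condition on adjacent lines, that the first entry of a line is not
`r`-related to the last entry of the preceding one, is stated for all the entries of any two lines,
to which it extends. -/
def IsRibbon (r : Fin n → Fin n → Bool) (L : List (List (Fin n))) : Prop :=
  (∀ l ∈ L, l ≠ [] ∧ l.Pairwise (fun a b => r a b)) ∧
    L.Pairwise (fun l m => ∀ a ∈ l, ∀ b ∈ m, r b a = false)

theorem isRibbon_nil : IsRibbon r [] := ⟨by simp, by simp⟩

theorem isRibbon_cons : IsRibbon r (l :: L) ↔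
    l ≠ [] ∧ l.Pairwise (fun a b => r a b) ∧ (∀ a ∈ l, ∀ b ∈ L.flatten, r b a = false) ∧
      IsRibbon r L := by
  simp only [IsRibbon, List.mem_cons, forall_eq_or_imp, List.pairwise_cons, List.mem_flatten]
  grind

/-- A ribbon whose first line has only one box. -/
theorem isRibbon_cons_singleton : IsRibbon r ([a] :: L) ↔
    (∀ b ∈ L.flatten, r b a = false) ∧ IsRibbon r L := by
  simp [isRibbon_cons]

/-- A ribbon whose first line has at least two boxes. -/
theorem isRibbon_cons_cons (hl : l ≠ []) : IsRibbon r ((a :: l) :: ls) ↔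
    (∀ b ∈ l, r a b) ∧ (∀ b ∈ ls.flatten, r b a = false) ∧ IsRibbon r (l :: ls) := by
  simp only [isRibbon_cons, List.pairwise_cons, List.mem_cons, forall_eq_or_imp]
  grind

/-- Induction on ribbons by adding a box before the first one, in the same line or in a new one. -/
@[elab_as_elim]
theorem lines_induction {P : (L : List (List (Fin n))) → (∀ l ∈ L, l ≠ []) → Prop}
    (nil : ∀ h, P [] h) (single : ∀ a h, P [[a]] h)
    (new : ∀ a l ls, l ≠ [] → ∀ h' h, P (l :: ls) h' → P ([a] :: l :: ls) h)
    (extend : ∀ a l ls, l ≠ [] → ∀ h' h, P (l :: ls) h' → P ((a :: l) :: ls) h)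
    (L : List (List (Fin n))) (hL : ∀ l ∈ L, l ≠ []) : P L hL := by
  induction L with
  | nil => exact nil hL
  | cons l ls ih =>
    have hls : ∀ l ∈ ls, l ≠ [] := fun m hm => hL m (by simp [hm])
    induction l with
    | nil => exact absurd rfl (hL [] (by simp))
    | cons a l ihl =>
      by_cases hl : l = []
      · subst hl
        cases ls with
        | nil => exact single a hL
        | cons m ls => exact new a m ls (hls m (by simp)) hls hL (ih hls)
      · have hL' : ∀ m ∈ l :: ls, m ≠ [] := by
          simpa only [List.mem_cons, forall_eq_or_imp] using ⟨hl, hls⟩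
        exact extend a l ls hl hL' hL (ihl hL')

@[elab_as_elim]
theorem lines_cases {P : (L : List (List (Fin n))) → (∀ l ∈ L, l ≠ []) → Prop}
    (nil : ∀ h, P [] h) (single : ∀ a h, P [[a]] h)
    (new : ∀ a l ls, l ≠ [] → (∀ m ∈ l :: ls, m ≠ []) → ∀ h, P ([a] :: l :: ls) h)
    (extend : ∀ a l ls, l ≠ [] → (∀ m ∈ l :: ls, m ≠ []) → ∀ h, P ((a :: l) :: ls) h)
    (L : List (List (Fin n))) (hL : ∀ l ∈ L, l ≠ []) : P L hL :=
  lines_induction nil single (fun a l ls hl h' h _ => new a l ls hl h' h)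
    (fun a l ls hl h' h _ => extend a l ls hl h' h) L hL

theorem ribbonTranspose_singleton : ribbonTranspose [[a]] = [[a]] := rfl

theorem ribbonTranspose_singleton_cons {t : List (Fin n)} {ts : List (List (Fin n))}
    (h : ribbonTranspose L = t :: ts) : ribbonTranspose ([a] :: L) = (a :: t) :: ts := by
  rw [ribbonTranspose, h]
  simp

theorem ribbonTranspose_cons_cons (hl : l ≠ []) :
    ribbonTranspose ((a :: l) :: ls) = [a] :: ribbonTranspose (l :: ls) := by
  rw [ribbonTranspose, ribbonTranspose]
  cases ribbonTranspose ls with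
  | nil => simp
  | cons t ts => simp [List.dropLast_cons_of_ne_nil hl, List.getLast?_cons_of_ne_nil hl]

theorem exists_ribbonTranspose_eq_cons (hl : l ≠ []) :
    ∃ t ts, ribbonTranspose (l :: ls) = t :: ts ∧ t ≠ [] := by
  obtain ⟨a, l, rfl⟩ := List.exists_cons_of_ne_nil hl
  by_cases hl' : l = []
  · subst hl'
    cases h : ribbonTranspose ls with
    | nil => exact ⟨[a], [], by simp [ribbonTranspose, h], by simp⟩
    | cons t ts => exact ⟨a :: t, ts, ribbonTranspose_singleton_cons h, by simp⟩
  · exact ⟨[a], _, ribbonTranspose_cons_cons hl', by simp⟩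

theorem flatten_ribbonTranspose (hL : ∀ l ∈ L, l ≠ []) :
    (ribbonTranspose L).flatten = L.flatten := by
  induction L, hL using lines_induction with
  | nil h => rfl
  | single a h => rfl
  | new a l ls hl h' h ih =>
    obtain ⟨t, ts, ht, -⟩ := exists_ribbonTranspose_eq_cons (ls := ls) hl
    rw [ribbonTranspose_singleton_cons ht]
    simpa [ht] using ih
  | extend a l ls hl h' h ih =>
    rw [ribbonTranspose_cons_cons hl]
    simpa using ih

theorem ribbonTranspose_ribbonTranspose (hL : ∀ l ∈ L, l ≠ []) :
    ribbonTranspose (ribbonTranspose L) = L := by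
  induction L, hL using lines_induction with
  | nil h => rfl
  | single a h => rfl
  | new a l ls hl h' h ih =>
    obtain ⟨t, ts, ht, ht'⟩ := exists_ribbonTranspose_eq_cons (ls := ls) hl
    rw [ribbonTranspose_singleton_cons ht, ribbonTranspose_cons_cons ht', ← ht, ih]
  | extend a l ls hl h' h ih =>
    rw [ribbonTranspose_cons_cons hl, ribbonTranspose_singleton_cons ih]

/-- As for Young tableaux, the exchange of rows and columns replaces `r` by the negation of its
converse. -/
theorem IsRibbon.ribbonTranspose (hr : IsBumpRelation r) (hrs : ∀ a b, s a b = !r b a)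
    (hL : IsRibbon r L) : IsRibbon s (ribbonTranspose L) := by
  have hne : ∀ l ∈ L, l ≠ [] := fun l h => (hL.1 l h).1
  induction L, hne using lines_induction with
  | nil h => exact isRibbon_nil
  | single a h => simp [ribbonTranspose_singleton, IsRibbon]
  | new a l ls hl h' h ih =>
    obtain ⟨t, ts, ht, ht'⟩ := exists_ribbonTranspose_eq_cons (ls := ls) hl
    rw [isRibbon_cons_singleton] at hL
    have ih := ih hL.2
    have hf := flatten_ribbonTranspose (L := l :: ls) (fun m hm => (hL.2.1 m hm).1)
    rw [ht] at ih hf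
    rw [ribbonTranspose_singleton_cons ht, isRibbon_cons_cons ht']
    rw [← hf] at hL
    refine ⟨fun b hb => ?_, fun b hb => ?_, ih⟩
    · simp [hrs, hL.1 b (by simp [hb])]
    · obtain ⟨c, hc⟩ := List.exists_mem_of_ne_nil t ht'
      have h1 := (isRibbon_cons.1 ih).2.2.1 c hc b hb
      have h2 := hL.1 c (by simp [hc])
      simp only [hrs, Bool.not_eq_false'] at h1 ⊢
      rcases hr.negTrans h1 a with h | h
      · simp [h] at h2
      · exact h
  | extend a l ls hl h' h ih =>
    rw [isRibbon_cons_cons hl] at hL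
    rw [ribbonTranspose_cons_cons hl, isRibbon_cons_singleton,
      flatten_ribbonTranspose (fun m hm => (hL.2.2.1 m hm).1)]
    refine ⟨fun b hb => ?_, ih hL.2.2⟩
    simp only [hrs, Bool.not_eq_false']
    rw [List.flatten_cons, List.mem_append] at hb
    rcases hb with hb | hb
    · exact hL.1 b hb
    · obtain ⟨c, hc⟩ := List.exists_mem_of_ne_nil l hl
      rcases hr.negTrans (hL.1 c hc) b with h | h
      · exact h
      · simp [(isRibbon_cons.1 hL.2.2).2.2.1 c hc b hb] at h

theorem le_eq_not_lt (a b : Fin n) : decide (a ≤ b) = !decide (b < a) := by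
  rw [← decide_not, decide_eq_decide, not_lt]

theorem lt_eq_not_le (a b : Fin n) : decide (a < b) = !decide (b ≤ a) := by
  rw [← decide_not, decide_eq_decide, not_le]

theorem mem_columnReading : a ∈ columnReading L ↔ a ∈ L.flatten := by
  simp [columnReading]

theorem mem_rowReading : a ∈ rowReading L ↔ a ∈ L.flatten := by
  simp [rowReading]

theorem perm_columnReading : (columnReading L).Perm L.flatten := by
  induction L with
  | nil => rfl
  | cons l L ih => simpa using (List.reverse_perm l).append ih

/-- The column reading and the row reading of a quasi-ribbon tableau agree in the hypoplactic
monoid. -/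
theorem hypoplactic_columnReading_rowReading (hL : IsRibbon (fun a b => decide (a < b)) L) :
    Hypoplactic (columnReading L) (rowReading (ribbonTranspose L)) := by
  have C := Hypoplactic.isWordCongruence (α := Fin n)
  have hne : ∀ l ∈ L, l ≠ [] := fun l h => (hL.1 l h).1
  induction L, hne using lines_induction with
  | nil h => exact C.refl _
  | single a h => exact C.refl _
  | new a l ls hl h' h ih =>
    have hT := hL.ribbonTranspose isBumpRelation_lt le_eq_not_lt
    obtain ⟨t, ts, ht, ht'⟩ := exists_ribbonTranspose_eq_cons (ls := ls) hl
    have ih := ih (isRibbon_cons_singleton.1 hL).2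
    rw [ribbonTranspose_singleton_cons ht] at hT ⊢
    rw [isRibbon_cons_cons ht', isRibbon_cons] at hT
    rw [ht, rowReading_cons] at ih
    rw [columnReading_cons, rowReading_cons]
    refine C.trans (C.append (C.refl [a]) ih) ⟨?_, fun a' b hab hc => ?_⟩
    · simpa using List.perm_middle.symm
    · obtain ⟨c, hc'⟩ := List.exists_mem_of_ne_nil t ht'
      have h1 : a ≤ c := by simpa using hT.1 c hc'
      have h2 : ∀ d ∈ rowReading ts, c < d := fun d hd => by
        simpa using hT.2.2.2.2.1 c hc' d (mem_rowReading.1 hd)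
      have h3 := hc c (by simp [hc'])
      simp only [List.singleton_append, pair_sublist_cons, pair_sublist_append, List.mem_cons,
        List.mem_append]
      clear ih hT C
      grind
  | extend a l ls hl h' h ih =>
    have hL' := (isRibbon_cons_cons hl).1 hL
    have ih := ih hL'.2.2
    rw [ribbonTranspose_cons_cons hl, rowReading_cons]
    refine C.trans ?_ (C.append ih (C.refl [a]))
    obtain ⟨c, hc'⟩ := List.exists_mem_of_ne_nil l hl
    have h1 : a < c := by simpa using hL'.1 c hc'
    have h2 : ∀ d ∈ columnReading ls, c ≤ d := fun d hd => by
      simpa using (isRibbon_cons.1 hL'.2.2).2.2.1 c hc' d (mem_columnReading.1 hd)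
    simp only [columnReading_cons, List.reverse_cons, List.append_assoc]
    refine ⟨?_, fun a' b hab hc => ?_⟩
    · exact .append_left _ List.perm_append_comm
    · have h3 := hc c (by simp [hc'])
      have h4 : c ∈ l.reverse := by simpa using hc'
      simp only [List.singleton_append, pair_sublist_cons, pair_sublist_append, List.mem_cons,
        List.mem_append, List.not_mem_nil, or_false, List.sublist_nil]
      clear ih hL hL' C
      grind

/-- A quasi-ribbon tableau is determined by its sorted entries and by the steps of the ribbon: the
next two entries `a`, `b` are in the same column if and only if `a < b` and `b` is read before
`a`. -/
theorem IsRibbon.eq_of_hypoplactic {L' : List (List (Fin n))}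
    (hL : IsRibbon (fun a b => decide (a < b)) L) (hL' : IsRibbon (fun a b => decide (a < b)) L')
    (h : Hypoplactic (columnReading L) (columnReading L')) : L = L' := by
  have hsorted {K : List (List (Fin n))} (hK : IsRibbon (fun a b => decide (a < b)) K) :
      K.flatten.Pairwise (· ≤ ·) := by
    induction K with
    | nil => simp
    | cons l K ih =>
      rw [isRibbon_cons] at hK
      rw [List.flatten_cons, List.pairwise_append]
      refine ⟨hK.2.1.imp fun h => ?_, ih hK.2.2.2, fun a ha b hb => ?_⟩
      · exact le_of_lt (by simpa using h)
      · simpa using hK.2.2.1 a ha b hb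
  have hflat : L.flatten = L'.flatten :=
    ((perm_columnReading.symm.trans h.1).trans perm_columnReading).eq_of_pairwise
      (fun _ _ _ _ => le_antisymm) (hsorted hL) (hsorted hL')
  have hinv := h.2
  simp only [mem_columnReading] at hinv
  clear h
  have hne : ∀ l ∈ L, l ≠ [] := fun l h => (hL.1 l h).1
  have hne' : ∀ l ∈ L', l ≠ [] := fun l h => (hL'.1 l h).1
  have hS := hsorted hL
  -- If the first two entries `a`, `b` are in the same column of one tableau but not of the other,
  -- then only the first tableau has `b` before `a` in its reading.
  have key {a : Fin n} {l m : List (Fin n)} {ls ms : List (List (Fin n))} (hl : l ≠ [])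
      (hm : m ≠ []) (hL : IsRibbon (fun a b => decide (a < b)) ((a :: l) :: ls))
      (hf : (l :: ls).flatten = (m :: ms).flatten)
      (hinv : ∀ a' b, a' < b → (∀ c ∈ ((a :: l) :: ls).flatten, c ≤ a' ∨ b ≤ c) →
        ([b, a'].Sublist (columnReading ((a :: l) :: ls)) →
          [b, a'].Sublist (columnReading ([a] :: m :: ms)))) : False := by
    obtain ⟨b, l, rfl⟩ := List.exists_cons_of_ne_nil hl
    have hab : a < b := by simpa using ((isRibbon_cons_cons hl).1 hL).1 b (by simp)
    have hS := hsorted hL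
    simp only [List.flatten_cons, List.cons_append, List.pairwise_cons] at hS
    have h1 := hinv a b hab (by
      simp only [List.flatten_cons, List.cons_append, List.mem_cons]
      rintro c (rfl | rfl | hc)
      · exact .inl le_rfl
      · exact .inr le_rfl
      · exact .inr (hS.2.1 c hc)) (by simp)
    rw [columnReading_cons, List.reverse_singleton, List.singleton_append,
      pair_sublist_cons] at h1
    rcases h1 with h1 | h1
    · exact hab.ne' h1.1
    · have h2 : a ∈ (m :: ms).flatten := mem_columnReading.1 (h1.subset (by simp))
      rw [← hf, List.flatten_cons, List.cons_append, List.mem_cons] at h2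
      rcases h2 with h2 | h2
      · exact hab.ne h2
      · exact hab.not_ge (hS.2.1 a h2)
  have hS' {a : Fin n} {K : List (List (Fin n))}
      (hK : IsRibbon (fun a b => decide (a < b)) ([a] :: K)) : ∀ b ∈ K.flatten, a ≤ b := by
    simpa using (isRibbon_cons_singleton.1 hK).1
  induction L, hne using lines_induction generalizing L' with
  | nil h =>
    cases L' with
    | nil => rfl
    | cons l' L' => simp [hne' l' (by simp)] at hflat
  | single a h =>
    cases L', hne' using lines_cases with
    | nil => simp at hflat
    | single a' => simpa using hflat
    | new a' l' ls' hl' => simp [hl'] at hflat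
    | extend a' l' ls' hl' => simp [hl'] at hflat
  | new a l ls hl h' h ih =>
    cases L', hne' using lines_cases with
    | nil => simp at hflat
    | single a' => simp [hl] at hflat
    | new a' l' ls' hl' hls' =>
      simp only [List.flatten_cons, List.singleton_append, List.cons.injEq] at hflat
      obtain ⟨rfl, hflat⟩ := hflat
      refine congrArg ([a] :: ·) (ih (isRibbon_cons_singleton.1 hL).2
        (isRibbon_cons_singleton.1 hL').2 hflat (fun a' b hab hc => ?_) hls'
        (List.pairwise_cons.1 hS).2)
      by_cases ha' : a' ∈ (l :: ls).flatten
      · have haa' : a ≤ a' := hS' hL a' ha'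
        have h1 := hinv a' b hab fun c hc' => by
          rw [List.flatten_cons, List.singleton_append, List.mem_cons] at hc'
          rcases hc' with rfl | hc'
          · exact .inl haa'
          · exact hc c hc'
        rw [columnReading_cons, columnReading_cons [a], List.reverse_singleton,
          List.singleton_append, List.singleton_append, pair_sublist_cons, pair_sublist_cons] at h1
        simpa [(haa'.trans_lt hab).ne'] using h1
      · exact iff_of_false (fun hs => ha' (mem_columnReading.1 (hs.subset (by simp))))
          fun hs => ha' (by
            rw [List.flatten_cons, hflat]
            exact mem_columnReading.1 (hs.subset (by simp)))
    | extend a' l' ls' hl' hls' =>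
      simp only [List.flatten_cons, List.cons_append,
        List.cons.injEq] at hflat
      obtain ⟨rfl, hf⟩ := hflat
      refine (key hl' hl hL' (by simpa using hf.symm) fun a' b hab hc => (hinv a' b hab ?_).2).elim
      simpa [hf] using hc
  | extend a l ls hl h' h ih =>
    cases L', hne' using lines_cases with
    | nil => simp at hflat
    | single a' => simp [hl] at hflat
    | new a' l' ls' hl' hls' =>
      simp only [List.flatten_cons, List.cons_append,
        List.cons.injEq] at hflat
      obtain ⟨rfl, hf⟩ := hflat
      exact (key hl hl' hL (by simpa using hf) fun a' b hab hc => (hinv a' b hab hc).1).elim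
    | extend a' l' ls' hl' hls' =>
      simp only [List.flatten_cons, List.cons_append, List.cons.injEq] at hflat
      obtain ⟨rfl, hflat⟩ := hflat
      have hK := (isRibbon_cons_cons hl).1 hL
      have h2 := ih hK.2.2 ((isRibbon_cons_cons hl').1 hL').2.2 hflat (fun a' b hab hc => ?_) hls'
        (List.pairwise_cons.1 hS).2
      · simp only [List.cons.injEq] at h2 ⊢
        exact ⟨⟨trivial, h2.1⟩, h2.2⟩
      · by_cases ha' : a' ∈ (l :: ls).flatten
        · have haa' : a < a' := by
            rw [List.flatten_cons, List.mem_append] at ha'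
            obtain ⟨c, hc⟩ := List.exists_mem_of_ne_nil l hl
            rcases ha' with ha' | ha'
            · simpa using hK.1 a' ha'
            · have h3 : a < c := by simpa using hK.1 c hc
              have h4 : c ≤ a' := by simpa using (isRibbon_cons.1 hK.2.2).2.2.1 c hc a' ha'
              exact h3.trans_le h4
          have h1 := hinv a' b hab fun c hc' => by
            rw [List.flatten_cons, List.cons_append, List.mem_cons] at hc'
            rcases hc' with rfl | hc'
            · exact .inl haa'.le
            · exact hc c hc'
          simp only [columnReading_cons, List.reverse_cons, List.append_assoc,
            List.singleton_append, pair_sublist_append, pair_sublist_cons, List.mem_cons] at h1 ⊢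
          simpa [haa'.ne', (haa'.trans hab).ne'] using h1
        · exact iff_of_false (fun hs => ha' (mem_columnReading.1 (hs.subset (by simp))))
            fun hs => ha' (by
              rw [List.flatten_cons, hflat]
              exact mem_columnReading.1 (hs.subset (by simp)))

end Ribbons

/-! ### Insertion in quasi-ribbon tableaux -/

section RibbonInsertion

variable {n : ℕ} {R : List (List (Fin n))}

theorem ribbonRightAux_eq (R : List (List (Fin n))) (x : Fin n) :
    (ribbonRightAux R x = none ∧ ∀ a ∈ R.flatten, x < a) ∨
      ∃ A p c q B, R = A ++ (p ++ c :: q) :: B ∧ c ≤ x ∧ (∀ a ∈ q, x < a) ∧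
        (∀ a ∈ B.flatten, x < a) ∧ ribbonRightAux R x =
          some (A ++ (p ++ [c, x]) :: ([q].filter (fun l => !l.isEmpty) ++ B)) := by
  induction R with
  | nil => simp [ribbonRightAux]
  | cons r R ih =>
    rcases ih with ⟨h, hR⟩ | ⟨A, p, c, q, B, rfl, hc, hq, hB, h⟩
    · have hsplit : r.rdropWhile (fun a => decide (x < a)) ++
          r.rtakeWhile (fun a => decide (x < a)) = r := by
        rw [List.rdropWhile, List.rtakeWhile, ← List.reverse_append,
          List.takeWhile_append_dropWhile, List.reverse_reverse]
      have hq : ∀ a ∈ r.rtakeWhile (fun a => decide (x < a)), x < a := fun a ha => by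
        simpa using List.mem_rtakeWhile_imp ha
      rcases List.eq_nil_or_concat' (r.rdropWhile (fun a => decide (x < a))) with h0 | ⟨p, c, h0⟩
      · refine .inl ⟨by simp [ribbonRightAux, h, h0], ?_⟩
        rw [h0, List.nil_append] at hsplit
        rw [hsplit] at hq
        simp only [List.flatten_cons, List.mem_append]
        rintro a (ha | ha)
        · exact hq a ha
        · exact hR a ha
      · have hc : c ≤ x := by
          have := List.rdropWhile_last_not (fun a => decide (x < a)) r (by simp [h0])
          simpa [h0] using this
        refine .inr ⟨[], p, c, _, R, ?_, hc, hq, hR, ?_⟩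
        · rw [h0] at hsplit
          simpa using hsplit.symm
        · rw [ribbonRightAux, h, h0]
          cases p <;> simp
    · exact .inr ⟨r :: A, p, c, q, B, rfl, hc, hq, hB, by simp [ribbonRightAux, h]⟩

theorem ribbonLeft_eq (R : List (List (Fin n))) (x : Fin n) :
    (ribbonLeft R x = R ++ [[x]] ∧ ∀ a ∈ R.flatten, a < x) ∨
      ∃ A p c q B, R = A ++ (p ++ c :: q) :: B ∧ x ≤ c ∧ (∀ a ∈ p, a < x) ∧
        (∀ a ∈ A.flatten, a < x) ∧ ribbonLeft R x =
          A ++ ([p].filter (fun l => !l.isEmpty) ++ (x :: c :: q) :: B) := by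
  induction R with
  | nil => simp [ribbonLeft]
  | cons r R ih =>
    rcases forall_lt_or_exists_split r x with hr | ⟨p, c, q, rfl, hp, hc⟩
    · have h0 : r.dropWhile (fun a => decide (a < x)) = [] :=
        List.dropWhile_eq_nil_iff.2 (by simpa using hr)
      have h1 : ribbonLeft (r :: R) x = r :: ribbonLeft R x := by rw [ribbonLeft, h0]
      have hr' (A : List (List (Fin n))) (hA : ∀ a ∈ A.flatten, a < x) :
          ∀ a ∈ (r :: A).flatten, a < x := by
        simp only [List.flatten_cons, List.mem_append]
        rintro a (ha | ha)
        · exact hr a ha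
        · exact hA a ha
      rcases ih with ⟨h, hR⟩ | ⟨A, p, c, q, B, rfl, hc, hp, hA, h⟩
      · exact .inl ⟨by rw [h1, h]; rfl, hr' R hR⟩
      · exact .inr ⟨r :: A, p, c, q, B, rfl, hc, hp, hr' A hA, by rw [h1, h]; rfl⟩
    · refine .inr ⟨[], p, c, q, R, rfl, hc, hp, by simp, ?_⟩
      rw [ribbonLeft, List.dropWhile_append_of_pos (by simpa using hp),
        List.takeWhile_append_of_pos (by simpa using hp)]
      simp [hc]

theorem rowReading_filter_append (q : List (Fin n)) (B : List (List (Fin n))) :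
    rowReading ([q].filter (fun l => !l.isEmpty) ++ B) = rowReading B ++ q := by
  cases q <;> simp

theorem isRibbon_append {r : Fin n → Fin n → Bool} {A B : List (List (Fin n))} :
    IsRibbon r (A ++ B) ↔ IsRibbon r A ∧ IsRibbon r B ∧
      ∀ a ∈ A.flatten, ∀ b ∈ B.flatten, r b a = false := by
  induction A with
  | nil => simp [isRibbon_nil]
  | cons l A ih =>
    simp only [List.cons_append, isRibbon_cons, ih, List.flatten_cons, List.flatten_append,
      List.mem_append]
    grind

theorem isRibbon_filter {r : Fin n → Fin n → Bool} {q : List (Fin n)} :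
    IsRibbon r ([q].filter (fun l => !l.isEmpty)) ↔ q.Pairwise (fun a b => r a b) := by
  cases q <;> simp [IsRibbon]

theorem flatten_filter (q : List (Fin n)) :
    ([q].filter (fun l => !l.isEmpty)).flatten = q := by
  cases q <;> simp

theorem isRibbon_ribbonRight (hR : IsRibbon (fun a b => decide (a ≤ b)) R) (x : Fin n) :
    IsRibbon (fun a b => decide (a ≤ b)) (ribbonRight R x) := by
  rcases ribbonRightAux_eq R x with ⟨h, h'⟩ | ⟨A, p, c, q, B, rfl, hc, hq, hB, h⟩
  · rw [ribbonRight, h, Option.getD_none, isRibbon_cons_singleton]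
    exact ⟨by simpa using h', hR⟩
  · rw [ribbonRight, h, Option.getD_some]
    simp only [isRibbon_append, isRibbon_cons, List.flatten_cons, List.mem_append,
      flatten_filter, isRibbon_filter, List.pairwise_append, List.pairwise_cons, decide_eq_true_eq,
      decide_eq_false_iff_not, not_le] at hR ⊢
    obtain ⟨h1, ⟨h2, h3, h4, h5⟩, h6⟩ := hR
    clear h
    refine ⟨h1, ⟨by simp, ?_, ?_, h3.2.1.2, h5, ?_⟩, ?_⟩ <;> grind

/-- The words of a right insertion of `x`, where `c ≤ x` is the entry after which `x` is put. The
letters of `p` and `q` are exchanged, but `x` separates them; so are `x` and the letters of `w`, but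
`c` separates them. Neighbouring letters among them therefore involve `x` itself, and `x` also
occurs on the other side. -/
theorem hypoplactic_insert_right {p q w : List (Fin n)} {c x : Fin n} (hc : c ∈ p)
    (hp : ∀ a ∈ p, a ≤ x) (hw : ∀ a ∈ w, a < c) (hq : ∀ a ∈ q, x < a) :
    Hypoplactic (q ++ (p ++ [x]) ++ w) (p ++ q ++ w ++ [x]) := by
  refine ⟨?_, fun a b hab hgap => ?_⟩
  · rw [List.perm_iff_count]
    intro a
    simp only [List.count_append]
    omega
  · have hgc := hgap c (by simp [hc])
    have hgx := hgap x (by simp)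
    clear hgap
    simp only [pair_sublist_append, List.mem_append, List.mem_singleton]
    generalize [b, a].Sublist p = s₁, [b, a].Sublist q = s₂, [b, a].Sublist w = s₃,
      [b, a].Sublist [x] = s₄
    grind

/-- The words of a left insertion of `x`; see `hypoplactic_insert_right`. -/
theorem hypoplactic_insert_left {p q w : List (Fin n)} {c x : Fin n} (hc : c ∈ q)
    (hq : ∀ a ∈ q, x ≤ a) (hw : ∀ a ∈ w, c < a) (hp : ∀ a ∈ p, a < x) :
    Hypoplactic (w ++ ([x] ++ (q ++ p))) ([x] ++ (w ++ (p ++ q))) := by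
  refine ⟨?_, fun a b hab hgap => ?_⟩
  · rw [List.perm_iff_count]
    intro a
    simp only [List.count_append]
    omega
  · have hgc := hgap c (by simp [hc])
    have hgx := hgap x (by simp)
    clear hgap
    simp only [pair_sublist_append, List.mem_append, List.mem_singleton]
    generalize [b, a].Sublist p = s₁, [b, a].Sublist q = s₂, [b, a].Sublist w = s₃,
      [b, a].Sublist [x] = s₄
    grind

theorem hypoplactic_rowReading_ribbonRight (hR : IsRibbon (fun a b => decide (a ≤ b)) R)
    (x : Fin n) : Hypoplactic (rowReading (ribbonRight R x)) (rowReading R ++ [x]) := by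
  have C := Hypoplactic.isWordCongruence (α := Fin n)
  rcases ribbonRightAux_eq R x with ⟨h, h'⟩ | ⟨A, p, c, q, B, rfl, hc, hq, hB, h⟩
  · rw [ribbonRight, h, Option.getD_none, rowReading_cons]
    exact C.refl _
  · rw [ribbonRight, h, Option.getD_some, rowReading_append, rowReading_cons,
      rowReading_filter_append, rowReading_append, rowReading_cons]
    simp only [isRibbon_append, isRibbon_cons, List.flatten_cons, List.mem_append,
      List.pairwise_append, List.pairwise_cons, ← mem_rowReading, decide_eq_true_eq,
      decide_eq_false_iff_not, not_le] at hR hB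
    obtain ⟨-, ⟨-, h3, -, -⟩, h6⟩ := hR
    have e1 : rowReading B ++ q ++ (p ++ [c, x]) ++ rowReading A =
      rowReading B ++ (q ++ (p ++ [c] ++ [x]) ++ rowReading A) := by simp
    have e2 : rowReading B ++ (p ++ c :: q) ++ rowReading A ++ [x] =
      rowReading B ++ (p ++ [c] ++ q ++ rowReading A ++ [x]) := by simp
    rw [e1, e2]
    exact C.append (C.refl _) (hypoplactic_insert_right (c := c) (by simp) (by grind)
      (fun a ha => h6 a ha c (by simp)) hq)

theorem isRibbon_ribbonLeft (hR : IsRibbon (fun a b => decide (a ≤ b)) R) (x : Fin n) :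
    IsRibbon (fun a b => decide (a ≤ b)) (ribbonLeft R x) := by
  rcases ribbonLeft_eq R x with ⟨h, h'⟩ | ⟨A, p, c, q, B, rfl, hc, hp, hA, h⟩
  · rw [h, isRibbon_append, isRibbon_cons_singleton]
    exact ⟨hR, ⟨by simp, isRibbon_nil⟩, by simpa using h'⟩
  · rw [h]
    simp only [isRibbon_append, isRibbon_cons, List.flatten_cons, List.mem_append,
      flatten_filter, isRibbon_filter, List.pairwise_append, List.pairwise_cons, decide_eq_true_eq,
      decide_eq_false_iff_not, not_le] at hR ⊢
    obtain ⟨h1, ⟨h2, h3, h4, h5⟩, h6⟩ := hR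
    clear h
    refine ⟨h1, ⟨h3.1, ⟨by simp, ?_, ?_, h5⟩, ?_⟩, ?_⟩ <;> grind

theorem hypoplactic_rowReading_ribbonLeft (hR : IsRibbon (fun a b => decide (a ≤ b)) R)
    (x : Fin n) : Hypoplactic (rowReading (ribbonLeft R x)) (x :: rowReading R) := by
  have C := Hypoplactic.isWordCongruence (α := Fin n)
  rcases ribbonLeft_eq R x with ⟨h, h'⟩ | ⟨A, p, c, q, B, rfl, hc, hp, hA, h⟩
  · rw [h, rowReading_append]
    exact C.refl _
  · rw [h, rowReading_append, rowReading_filter_append, rowReading_cons, rowReading_append,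
      rowReading_cons]
    simp only [isRibbon_append, isRibbon_cons, List.flatten_cons, List.mem_append,
      List.pairwise_append, List.pairwise_cons, ← mem_rowReading, decide_eq_true_eq,
      decide_eq_false_iff_not, not_le] at hR hA
    obtain ⟨-, ⟨-, h3, h4, -⟩, h6⟩ := hR
    have e1 : rowReading B ++ x :: c :: q ++ p ++ rowReading A =
      (rowReading B ++ ([x] ++ (c :: q ++ p))) ++ rowReading A := by simp
    have e2 : x :: (rowReading B ++ (p ++ c :: q) ++ rowReading A) =
      ([x] ++ (rowReading B ++ (p ++ c :: q))) ++ rowReading A := by simp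
    rw [e1, e2]
    exact C.append (hypoplactic_insert_left (c := c) (by simp) (by grind)
      (fun a ha => h4 c (by simp) a ha) hp) (C.refl _)

end RibbonInsertion

/-! ### The four string data structures -/

section Structures

variable {n : ℕ} {u u' : List (Fin n)} {w : GluedString n}

theorem ofGluingMap_mem_Scol (g : List (Fin n) → List (Fin n) → ℤ) {L : List (List (Fin n))}
    (hL : ∀ u ∈ L, IsColumn u) : ofGluingMap g L ∈ Scol n :=
  ⟨hL, by simp [ofGluingMap]⟩

theorem isColumn_iff : IsColumn u ↔ u ≠ [] ∧ u.Pairwise (fun a b => decide (a < b)) := by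
  simp [IsColumn]

theorem inScolc_youngGlue (hu' : u' ≠ []) :
    u'.length ≤ u.length ∧ InScolc u (youngGlue u u') u' ↔
      Dominates (fun a b => decide (a < b)) u u' := by
  have h0 := List.length_pos_of_ne_nil hu'
  rw [dominates_iff]
  refine and_congr_right fun hl => ?_
  simp only [InScolc, RowConnected, RowIncreasing, youngGlue, decide_eq_false_iff_not, not_lt]
  constructor
  · rintro ⟨-, h⟩ i a ha b hb
    exact h i i (by omega) a ha b hb
  · refine fun h => ⟨by omega, fun i j hij a ha b hb => ?_⟩
    obtain rfl : i = j := by omega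
    exact h i a ha b hb

theorem mem_young_iff :
    w ∈ Young n ↔ w = ofGluingMap youngGlue w.cols ∧
      IsTableau (fun a b => decide (a < b)) w.cols := by
  constructor
  · rintro ⟨⟨hc, -⟩, hg, h⟩
    refine ⟨hg, fun u hu => isColumn_iff.1 (hc u hu), ?_⟩
    rw [List.isChain_iff_getElem] at h ⊢
    exact fun i hi => (inScolc_youngGlue (hc _ (List.getElem_mem _)).1).1 (h i hi)
  · rintro ⟨hg, hc, h⟩
    have hc' : ∀ u ∈ w.cols, IsColumn u := fun u hu => isColumn_iff.2 (hc u hu)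
    refine ⟨hg ▸ ofGluingMap_mem_Scol _ hc', hg, ?_⟩
    rw [List.isChain_iff_getElem] at h ⊢
    exact fun i hi => (inScolc_youngGlue (hc _ (List.getElem_mem _)).1).2 (h i hi)

theorem inScolc_ribbonGlue (hu : IsColumn u) (hu' : IsColumn u') :
    InScolc u (ribbonGlue u u') u' ↔ ∀ a ∈ u, ∀ b ∈ u', a ≤ b := by
  have h0 := List.length_pos_of_ne_nil hu.1
  have h0' := List.length_pos_of_ne_nil hu'.1
  simp only [InScolc, RowConnected, RowIncreasing, ribbonGlue]
  constructor
  · rintro ⟨-, h⟩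
    obtain ⟨p, c, rfl⟩ := (List.eq_nil_or_concat' u).resolve_left hu.1
    obtain ⟨d, q, rfl⟩ := List.exists_cons_of_ne_nil hu'.1
    have hcd := h p.length 0 (by push_cast [List.length_append, List.length_singleton]; ring)
      c (by simp) d (by simp)
    have h1 : ∀ a ∈ p ++ [c], a ≤ c := by
      simpa [or_imp, forall_and] using
        fun a ha => ((List.pairwise_append.1 hu.2).2.2 a ha c (by simp)).le
    have h2 : ∀ b ∈ d :: q, d ≤ b := by
      simpa using fun b hb => ((List.pairwise_cons.1 hu'.2).1 b hb).le
    exact fun a ha b hb => (h1 a ha).trans (hcd.trans (h2 b hb))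
  · exact fun h => ⟨by omega, fun i j _ a ha b hb =>
      h a (List.mem_of_getElem? ha) b (List.mem_of_getElem? hb)⟩

theorem isRibbon_lt_iff {L : List (List (Fin n))} (hL : ∀ u ∈ L, IsColumn u) :
    IsRibbon (fun a b => decide (a < b)) L ↔
      L.IsChain (fun u u' => InScolc u (ribbonGlue u u') u') := by
  induction L with
  | nil => simp [isRibbon_nil]
  | cons u L ih =>
    have ih := ih fun v hv => hL v (by simp [hv])
    have hu := isColumn_iff.1 (hL u (by simp))
    cases L with
    | nil => simpa [isRibbon_cons, isRibbon_nil, hu.1] using hu.2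
    | cons v L =>
      have hv := hL v (by simp)
      rw [List.isChain_cons_cons, ← ih, isRibbon_cons, inScolc_ribbonGlue (hL u (by simp)) hv]
      simp only [hu.2, ne_eq, hu.1, not_false_eq_true, true_and, List.flatten_cons,
        List.mem_append, decide_eq_false_iff_not, not_lt]
      refine and_congr_left fun h => ⟨fun h' a ha b hb => h' a ha b (.inl hb), ?_⟩
      rintro h' a ha b (hb | hb)
      · exact h' a ha b hb
      · obtain ⟨c, hc⟩ := List.exists_mem_of_ne_nil v hv.1
        exact (h' a ha c hc).trans (by simpa using (isRibbon_cons.1 h).2.2.1 c hc b hb)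

theorem mem_quasiRibbon_iff :
    w ∈ QuasiRibbon n ↔ w = ofGluingMap ribbonGlue w.cols ∧
      IsRibbon (fun a b => decide (a < b)) w.cols := by
  constructor
  · rintro ⟨⟨hc, -⟩, hg, h⟩
    exact ⟨hg, (isRibbon_lt_iff hc).2 h⟩
  · rintro ⟨hg, h⟩
    have hc : ∀ u ∈ w.cols, IsColumn u := fun u hu => isColumn_iff.2 (h.1 u hu)
    exact ⟨hg ▸ ofGluingMap_mem_Scol _ hc, hg, (isRibbon_lt_iff hc).1 h⟩

theorem ofGluingMap_youngGlue_mem {L : List (List (Fin n))}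
    (hL : IsTableau (fun a b => decide (a < b)) L) : ofGluingMap youngGlue L ∈ Young n :=
  mem_young_iff.2 ⟨rfl, hL⟩

theorem ofGluingMap_ribbonGlue_mem {L : List (List (Fin n))}
    (hL : IsRibbon (fun a b => decide (a < b)) L) : ofGluingMap ribbonGlue L ∈ QuasiRibbon n :=
  mem_quasiRibbon_iff.2 ⟨rfl, hL⟩

theorem eq_of_plactic_readSW {d d' : GluedString n} (hd : d ∈ Young n) (hd' : d' ∈ Young n)
    (h : Plactic (readSW d) (readSW d')) : d = d' := by
  rw [mem_young_iff] at hd hd'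
  rw [hd.1, hd'.1, hd.2.eq_of_plactic hd'.2 h]

theorem eq_of_hypoplactic_readSW {d d' : GluedString n} (hd : d ∈ QuasiRibbon n)
    (hd' : d' ∈ QuasiRibbon n) (h : Hypoplactic (readSW d) (readSW d')) : d = d' := by
  rw [mem_quasiRibbon_iff] at hd hd'
  rw [hd.1, hd'.1, hd.2.eq_of_hypoplactic hd'.2 h]

theorem emptyString_mem_young : emptyString n ∈ Young n :=
  mem_young_iff.2 ⟨rfl, isTableau_nil⟩

theorem emptyString_mem_quasiRibbon : emptyString n ∈ QuasiRibbon n :=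
  mem_quasiRibbon_iff.2 ⟨rfl, isRibbon_nil⟩

theorem schenstedLeft_mem (hw : w ∈ Young n) (x : Fin n) : schenstedLeft w x ∈ Young n :=
  ofGluingMap_youngGlue_mem ((mem_young_iff.1 hw).2.bump isBumpRelation_lt x)

theorem plactic_readSW_schenstedLeft (hw : w ∈ Young n) (x : Fin n) :
    Plactic (readSW (schenstedLeft w x)) (x :: readSW w) :=
  plactic_columnReading_bump (mem_young_iff.1 hw).2 x

theorem schenstedRight_mem_and_read (hw : w ∈ Young n) (x : Fin n) :
    schenstedRight w x ∈ Young n ∧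
      Plactic (readSW (schenstedRight w x)) (readSW w ++ [x]) := by
  have hL := (mem_young_iff.1 hw).2
  have h1 := hL.transpose isBumpRelation_lt isBumpRelation_le le_eq_not_lt
  have h2 := h1.bump isBumpRelation_le x
  have h3 := h2.transpose isBumpRelation_le isBumpRelation_lt lt_eq_not_le
  have h4 := h2.transpose_transpose isBumpRelation_le isBumpRelation_lt lt_eq_not_le
  refine ⟨ofGluingMap_youngGlue_mem h3, ?_⟩
  have h5 := plactic_rowReading_transpose h3
  rw [h4] at h5
  exact h5.symm.trans ((plactic_rowReading_bump h1 x).trans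
    ((plactic_rowReading_transpose hL).append (.refl [x])))

theorem ribbonTranspose_mem_and_read {R : List (List (Fin n))}
    (hR : IsRibbon (fun a b => decide (a ≤ b)) R) :
    ofGluingMap ribbonGlue (ribbonTranspose R) ∈ QuasiRibbon n ∧
      Hypoplactic (columnReading (ribbonTranspose R)) (rowReading R) := by
  have h := hR.ribbonTranspose isBumpRelation_le lt_eq_not_le
  refine ⟨ofGluingMap_ribbonGlue_mem h, ?_⟩
  have h' := hypoplactic_columnReading_rowReading h
  rwa [ribbonTranspose_ribbonTranspose fun l hl => (hR.1 l hl).1] at h'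

theorem quasiRight_mem_and_read (hw : w ∈ QuasiRibbon n) (x : Fin n) :
    quasiRight w x ∈ QuasiRibbon n ∧
      Hypoplactic (readSW (quasiRight w x)) (readSW w ++ [x]) := by
  have C := Hypoplactic.isWordCongruence (α := Fin n)
  have hL := (mem_quasiRibbon_iff.1 hw).2
  have hR := hL.ribbonTranspose isBumpRelation_lt le_eq_not_lt
  obtain ⟨h1, h2⟩ := ribbonTranspose_mem_and_read (isRibbon_ribbonRight hR x)
  exact ⟨h1, C.trans h2 (C.trans (hypoplactic_rowReading_ribbonRight hR x)
    (C.append (C.symm (hypoplactic_columnReading_rowReading hL)) (C.refl _)))⟩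

theorem quasiLeft_mem_and_read (hw : w ∈ QuasiRibbon n) (x : Fin n) :
    quasiLeft w x ∈ QuasiRibbon n ∧
      Hypoplactic (readSW (quasiLeft w x)) (x :: readSW w) := by
  have C := Hypoplactic.isWordCongruence (α := Fin n)
  have hL := (mem_quasiRibbon_iff.1 hw).2
  have hR := hL.ribbonTranspose isBumpRelation_lt le_eq_not_lt
  obtain ⟨h1, h2⟩ := ribbonTranspose_mem_and_read (isRibbon_ribbonLeft hR x)
  exact ⟨h1, C.trans h2 (C.trans (hypoplactic_rowReading_ribbonLeft hR x)
    (C.append (C.refl [x]) (C.symm (hypoplactic_columnReading_rowReading hL))))⟩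

theorem isRight_Yrow : (Yrow n).IsRight :=
  StringData.isRight_of_crossSection Plactic.isWordCongruence emptyString_mem_young rfl
    (fun _ hd x => (schenstedRight_mem_and_read hd x).1)
    (fun _ hd x => (schenstedRight_mem_and_read hd x).2)
    (fun _ hd _ hd' h => eq_of_plactic_readSW hd hd' h)

theorem isLeft_Ycol : (Ycol n).IsLeft :=
  StringData.isLeft_of_crossSection Plactic.isWordCongruence emptyString_mem_young rfl
    (fun _ hd x => schenstedLeft_mem hd x)
    (fun _ hd x => plactic_readSW_schenstedLeft hd x)
    (fun _ hd _ hd' h => eq_of_plactic_readSW hd hd' h)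

theorem isRight_Qrow : (Qrow n).IsRight :=
  StringData.isRight_of_crossSection Hypoplactic.isWordCongruence emptyString_mem_quasiRibbon rfl
    (fun _ hd x => (quasiRight_mem_and_read hd x).1)
    (fun _ hd x => (quasiRight_mem_and_read hd x).2)
    (fun _ hd _ hd' h => eq_of_hypoplactic_readSW hd hd' h)

theorem isLeft_Qleft : (Qleft n).IsLeft :=
  StringData.isLeft_of_crossSection Hypoplactic.isWordCongruence emptyString_mem_quasiRibbon rfl
    (fun _ hd x => (quasiLeft_mem_and_read hd x).1)
    (fun _ hd x => (quasiLeft_mem_and_read hd x).2)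
    (fun _ hd _ hd' h => eq_of_hypoplactic_readSW hd hd' h)

end Structures

/-! ### The sliding rules -/

section Sliding

variable {n : ℕ} {u u' : List (Fin n)} {x y : Placed n} {T D : List (Placed n)} {P : ℤ} {p m : ℕ}

/-- The south-west reading of a sequence of placed columns. -/
def placedReading (D : List (Placed n)) : List (Fin n) := D.flatMap (fun x => x.2.reverse)

@[simp] theorem placedReading_nil : placedReading ([] : List (Placed n)) = [] := rfl

@[simp] theorem placedReading_cons : placedReading (x :: D) = x.2.reverse ++ placedReading D := by
  simp [placedReading]

@[simp] theorem placedReading_append : placedReading (D ++ T) =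
    placedReading D ++ placedReading T := by
  simp [placedReading]

theorem readSW_ofPlaced (D : List (Placed n)) : readSW (ofPlaced D) = placedReading D := by
  simp [readSW, ofPlaced, placedReading, List.flatMap_map]

/-- All the placed columns are columns. -/
def PlacedColumns (D : List (Placed n)) : Prop := ∀ x ∈ D, IsColumn x.2

theorem ofPlaced_mem_Scol_iff : ofPlaced D ∈ Scol n ↔ PlacedColumns D := by
  simp only [Scol, ofPlaced, Set.mem_ofPred_eq, PlacedColumns, List.mem_map,
    forall_exists_index, and_imp, forall_apply_eq_imp_iff₂, List.length_map, List.length_zipWith,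
    List.length_tail, and_iff_left_iff_imp]
  intro _
  omega

/-- The decomposition of two columns at a split. The boxes `b` and `d ∈ D` satisfy `b ≤ d` since
the first box of `D`, if there is one, is in the row of `b`. -/
theorem IsSplit.exists_decomposition (hu : IsColumn u) (hu' : IsColumn u')
    (hP : P = 0 ∨ InScolc u P u') (h : IsSplit u P u' p m) :
    ∃ A b B C c D, u = A ++ b :: B ∧ u' = C ++ c :: D ∧ p = A.length ∧ m = C.length + 1 ∧
      c < b ∧ (∀ a ∈ A, a ≤ c) ∧ ∀ d ∈ D, b ≤ d := by
  obtain ⟨hp, hm, hm', hpm, hlt, hle⟩ := h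
  have hm1 : m - 1 < u'.length := by omega
  have e1 : u.take p ++ u[p] :: u.drop (p + 1) = u := by simp
  have e2 : u'.take (m - 1) ++ u'[m - 1] :: u'.drop m = u' := by
    have := List.getElem_cons_drop hm1
    rw [Nat.sub_add_cancel hm] at this
    rw [this, List.take_append_drop]
  refine ⟨_, _, _, _, _, _, e1.symm, e2.symm, by simp [hp.le], by simp; omega,
    hlt _ (by simp [hm1]) _ (by simp [hp]), fun a ha => ?_, fun d hd => ?_⟩
  · have hp0 : p ≠ 0 := by rintro rfl; simp at ha
    have h1 := hle hp0 u[p - 1] (by simp) u'[m - 1] (by simp [hm1])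
    refine le_trans ?_ h1
    obtain ⟨i, hi, rfl⟩ := List.getElem_of_mem ha
    rw [List.getElem_take]
    rw [List.length_take] at hi
    rcases (show i ≤ p - 1 by omega).lt_or_eq with hlt' | rfl
    · exact (List.pairwise_iff_getElem.1 hu.2 i (p - 1) _ _ hlt').le
    · exact le_rfl
  · have hml : m < u'.length := by
      by_contra hml
      rw [List.drop_eq_nil_of_le (by omega)] at hd
      simp at hd
    have hadm : InScolc u P u' := by
      rcases hP with rfl | hP
      · omega
      · exact hP
    have h1 := hadm.2 p m hpm u[p] (by simp) u'[m] (by simp)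
    refine h1.trans ?_
    obtain ⟨i, hi, rfl⟩ := List.getElem_of_mem hd
    rw [List.getElem_drop]
    rw [List.length_drop] at hi
    rcases Nat.eq_zero_or_pos i with rfl | hi'
    · exact le_rfl
    · exact (List.pairwise_iff_getElem.1 hu'.2 m (m + i) _ _ (by omega)).le

/-- The word `s` precedes the word `t` lexicographically, and is not a prefix of `t`. -/
def LexBefore (s t : List (Fin n)) : Prop :=
  ∃ q a b s' t', s = q ++ a :: s' ∧ t = q ++ b :: t' ∧ a < b

theorem LexBefore.lt {s t : List (Fin n)} (h : LexBefore s t) (X Y : List (Fin n)) :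
    X ++ s ++ Y < X ++ t ++ Y := by
  obtain ⟨q, a, b, s', t', rfl, rfl, hab⟩ := h
  simp only [List.append_assoc, List.cons_append]
  exact List.append_left_lt (List.append_left_lt (.rel hab))

theorem placedReading_filter (D : List (Placed n)) :
    placedReading (D.filter (fun x => !x.2.isEmpty)) = placedReading D := by
  induction D with
  | nil => rfl
  | cons x D ih =>
    obtain ⟨t, v⟩ := x
    cases v <;> simp [ih]

/-- The readings of two columns `AB` and `CD` before and after a slide. The letters of `A` and `B`
are separated by `c`, those of `C` and `D` by `b`. -/
theorem hypoplactic_slide {A B C D : List (Fin n)} {b c : Fin n} (hb : b ∈ B)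
    (hB : ∀ a ∈ B, b ≤ a) (hc : c ∈ C) (hC : ∀ a ∈ C, a ≤ c) (hcb : c < b)
    (hA : ∀ a ∈ A, a ≤ c) (hD : ∀ a ∈ D, b ≤ a) :
    Hypoplactic (B ++ A ++ (D ++ C)) (A ++ B ++ (C ++ D)) := by
  refine ⟨List.perm_append_comm.append List.perm_append_comm, fun a' b' hab hgap => ?_⟩
  have hgc := hgap c (by simp [hc])
  have hgb := hgap b (by simp [hb])
  clear hgap
  simp only [pair_sublist_append, List.mem_append]
  generalize [b', a'].Sublist A = s₁, [b', a'].Sublist B = s₂, [b', a'].Sublist C = s₃,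
    [b', a'].Sublist D = s₄
  grind

/-- A slide yields columns, preserves the hypoplactic class of the reading, and either makes the
reading lexicographically smaller or keeps it and joins the two columns into one. -/
theorem slideRight_spec (hu : IsColumn u) (hu' : IsColumn u') (hP : P = 0 ∨ InScolc u P u')
    (h : IsSplit u P u' p m) (t t' : ℤ) :
    PlacedColumns (slideRight t u t' u' p m) ∧
      Hypoplactic (u.reverse ++ u'.reverse) (placedReading (slideRight t u t' u' p m)) ∧
      (LexBefore (placedReading (slideRight t u t' u' p m)) (u.reverse ++ u'.reverse) ∨
        placedReading (slideRight t u t' u' p m) = u.reverse ++ u'.reverse ∧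
          (slideRight t u t' u' p m).length < 2) := by
  obtain ⟨A, b, B, C, c, D, rfl, rfl, rfl, rfl, hcb, hAc, hbD⟩ := h.exists_decomposition hu hu' hP
  have hBb := (List.pairwise_cons.1 (List.pairwise_append.1 hu.2).2.1).1
  have hCc := fun a ha => (List.pairwise_append.1 hu'.2).2.2 a ha c (by simp)
  have hcD := (List.pairwise_cons.1 (List.pairwise_append.1 hu'.2).2.1).1
  have hslide : slideRight t (A ++ b :: B) t' (C ++ c :: D) A.length (C.length + 1) =
      [(t, A), (t', C ++ c :: b :: B), (t' + (C.length + 1 : ℕ), D)].filter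
        (fun x => !x.2.isEmpty) := by
    have e : C ++ c :: D = (C ++ [c]) ++ D := by simp
    have e' : C.length + 1 = (C ++ [c]).length := by simp
    rw [slideRight, List.take_left, List.drop_left, e, e', List.take_left, List.drop_left]
    simp
  rw [hslide, placedReading_filter]
  simp only [placedReading_cons, placedReading_nil, List.append_nil]
  refine ⟨?_, ?_, ?_⟩
  · intro z hz
    simp only [List.mem_filter, List.mem_cons, List.not_mem_nil, or_false, Bool.not_eq_true',
      List.isEmpty_eq_false_iff] at hz
    refine ⟨hz.2, ?_⟩
    rcases hz.1 with rfl | rfl | rfl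
    · exact (List.pairwise_append.1 hu.2).1
    · have h1 := (List.pairwise_append.1 hu.2).2.1
      have h2 := (List.pairwise_append.1 hu'.2).1
      rw [List.pairwise_append, List.pairwise_cons]
      refine ⟨h2, ⟨?_, h1⟩, ?_⟩ <;> grind
    · exact (List.pairwise_cons.1 (List.pairwise_append.1 hu'.2).2.1).2
  · have e1 : (A ++ b :: B).reverse ++ (C ++ c :: D).reverse =
        (b :: B).reverse ++ A.reverse ++ (D.reverse ++ (C ++ [c]).reverse) := by simp
    have e2 : A.reverse ++ ((C ++ c :: b :: B).reverse ++ D.reverse) =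
        A.reverse ++ (b :: B).reverse ++ ((C ++ [c]).reverse ++ D.reverse) := by simp
    rw [e1, e2]
    have h1 : ∀ a ∈ b :: B, b ≤ a := by
      simpa using fun a ha => (hBb a ha).le
    have h2 : ∀ a ∈ C ++ [c], a ≤ c := by
      simpa [or_imp, forall_and] using fun a ha => (hCc a ha).le
    exact hypoplactic_slide (b := b) (c := c) (by simp)
      (fun a ha => h1 a (List.mem_reverse.1 ha)) (by simp)
      (fun a ha => h2 a (List.mem_reverse.1 ha)) hcb (by simpa using hAc) (by simpa using hbD)
  · rcases List.eq_nil_or_concat' A with rfl | ⟨A, a, rfl⟩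
    · rcases List.eq_nil_or_concat' D with rfl | ⟨D, d, rfl⟩
      · refine .inr ⟨by simp, by simp⟩
      · refine .inl ⟨(b :: B).reverse, c, d, C.reverse ++ (D ++ [d]).reverse,
          (C ++ c :: D).reverse, by simp, by simp, hcD d (by simp)⟩
    · obtain ⟨B', β, hB⟩ := (List.eq_nil_or_concat' (b :: B)).resolve_left (by simp)
      have hβ : b ≤ β := by
        have : β ∈ b :: B := by simp [hB]
        rcases List.mem_cons.1 this with rfl | h'
        · exact le_rfl
        · exact (hBb β h').le
      refine .inl ⟨[], a, β, A.reverse ++ ((C ++ c :: b :: B).reverse ++ D.reverse),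
        B'.reverse ++ (A ++ [a]).reverse ++ (C ++ c :: D).reverse, by simp, ?_,
        ((hAc a (by simp)).trans_lt hcb).trans_le hβ⟩
      rw [hB]
      simp

theorem Rule.spec (h : Rule x y T) (hx : IsColumn x.2) (hy : IsColumn y.2) :
    PlacedColumns T ∧ Hypoplactic (placedReading [x, y]) (placedReading T) := by
  have C := Hypoplactic.isWordCongruence (α := Fin n)
  cases h with
  | alpha t u t' u' p m h hs =>
    have := slideRight_spec hx hy (.inr h) hs.1 t t'
    exact ⟨this.1, by simpa using this.2.1⟩
  | deltaAlpha t u t' u' P p m h hP hs =>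
    have := slideRight_spec hx hy hP.1 hs.1 t (t + P - u'.length)
    exact ⟨this.1, by simpa using this.2.1⟩
  | gamma t u t' u' P h hP hne =>
    exact ⟨by simpa [PlacedColumns] using ⟨hx, hy⟩, C.refl _⟩
  | delta t u t' u' hq hc h =>
    exact ⟨by simpa [PlacedColumns] using ⟨hx, hy⟩, C.refl _⟩

/-! ### Irreducible strings are quasi-ribbon tableaux -/

/-- Two adjacent placed columns that are glued as in a quasi-ribbon tableau. -/
def RibbonGlued (x y : Placed n) : Prop :=
  gluingPosition x y = ribbonGlue x.2 y.2 ∧ InScolc x.2 (ribbonGlue x.2 y.2) y.2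

theorem InScolc.le_ribbonGlue (h : InScolc u P u') : P ≤ ribbonGlue u u' := h.1.2

/-- An admissible gluing without split remains admissible one row below. -/
theorem InScolc.succ (h : InScolc u P u') (hlt : P < ribbonGlue u u')
    (hs : ∀ p m, ¬ IsSplit u P u' p m) : InScolc u (P + 1) u' := by
  refine ⟨⟨by linarith [h.1.1], hlt⟩, fun i j hij a ha b hb => ?_⟩
  by_contra! hba
  obtain ⟨hi, rfl⟩ := List.getElem?_eq_some_iff.1 (Option.mem_def.1 ha)
  obtain ⟨hj, rfl⟩ := List.getElem?_eq_some_iff.1 (Option.mem_def.1 hb)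
  refine hs i (j + 1) ⟨hi, by omega, hj, by push_cast; linarith, by simpa [hi, hj] using hba, ?_⟩
  intro hi0 a ha b hb
  exact h.2 (i - 1) j (by omega) a ha b (by simpa using hb)

theorem exists_isMinSplit (h : ∃ p m, IsSplit u P u' p m) : ∃ p m, IsMinSplit u P u' p m := by
  classical
  obtain ⟨m, hm⟩ := Nat.find_spec h
  exact ⟨_, m, hm, fun p' m' h' => Nat.find_min' h ⟨m', h'⟩⟩

theorem exists_isGreatest {S : Set ℤ} (hb : ∃ b, ∀ z ∈ S, z ≤ b) (hne : S.Nonempty) :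
    ∃ P, IsGreatest S P := by
  obtain ⟨P, h1, h2⟩ := Int.exists_greatest_of_bdd (P := (· ∈ S)) hb hne
  exact ⟨P, h1, h2⟩

/-- At the lowest admissible place the columns are glued as in a ribbon or can be split. -/
theorem eq_ribbonGlue_or_exists_isMinSplit (hP : IsGreatest {P : ℤ | InScolc u P u'} P) :
    P = ribbonGlue u u' ∨ ∃ p m, IsMinSplit u P u' p m := by
  by_contra! h
  have h1 := InScolc.succ hP.1 (lt_of_le_of_ne (InScolc.le_ribbonGlue hP.1) h.1) fun p m hs => by
    obtain ⟨p', m', h'⟩ := exists_isMinSplit ⟨p, m, hs⟩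
    exact h.2 p' m' h'
  have := hP.2 h1
  omega

/-- The replacement of `x`, `y` by `T` makes the reading lexicographically smaller, or preserves it
and decreases the number of columns. -/
def Decreases (x y : Placed n) (T : List (Placed n)) : Prop :=
  LexBefore (placedReading T) (placedReading [x, y]) ∨
    placedReading T = placedReading [x, y] ∧ T.length < 2

theorem exists_alpha {t t' : ℤ} (hu : IsColumn u) (hu' : IsColumn u')
    (hP : IsGreatest {P : ℤ | InScolc u P u'} (gluingPosition (t, u) (t', u'))) :
    RibbonGlued (t, u) (t', u') ∨
      ∃ T, Rule (t, u) (t', u') T ∧ Decreases (t, u) (t', u') T := by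
  rcases eq_ribbonGlue_or_exists_isMinSplit hP with h | ⟨p, m, h⟩
  · exact .inl ⟨h, h ▸ hP.1⟩
  · refine .inr ⟨_, .alpha t u t' u' p m hP.1 h, ?_⟩
    simpa [Decreases] using (slideRight_spec hu hu' (.inr hP.1) h.1 t t').2.2

/-- Two adjacent columns are glued as in a ribbon, or a slide applies to them, or the second one can
be moved so that one of these cases occurs. -/
theorem ribbonGlued_or_exists_rule (hx : IsColumn x.2) (hy : IsColumn y.2) :
    RibbonGlued x y ∨ (∃ T, Rule x y T ∧ Decreases x y T) ∨
      ∃ t', Rule x y [x, (t', y.2)] ∧ (RibbonGlued x (t', y.2) ∨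
        ∃ T, Rule x (t', y.2) T ∧ Decreases x (t', y.2) T) := by
  obtain ⟨t, u⟩ := x
  obtain ⟨t', u'⟩ := y
  have hk := List.length_pos_of_ne_nil hx.1
  have hl := List.length_pos_of_ne_nil hy.1
  simp only at hk hl hx hy
  have hmove (P : ℤ) : gluingPosition (t, u) (t + P - u'.length, u') = P := by
    simp [gluingPosition]
  by_cases hq : InScolc u (gluingPosition (t, u) (t', u')) u'
  · obtain ⟨P, hP⟩ := exists_isGreatest (S := {P : ℤ | InScolc u P u'})
      ⟨_, fun z hz => InScolc.le_ribbonGlue hz⟩ ⟨_, hq⟩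
    by_cases hne : P = gluingPosition (t, u) (t', u')
    · rcases exists_alpha hx hy (hne ▸ hP) with h | h
      · exact .inl h
      · exact .inr (.inl h)
    · exact .inr (.inr ⟨_, .gamma t u t' u' P (.inl hq) hP hne,
        exists_alpha hx hy ((hmove P).symm ▸ hP)⟩)
  · obtain ⟨P, hP⟩ := exists_isGreatest (S := {P : ℤ | P = 0 ∨ InScolc u P u'})
      ⟨max 0 (ribbonGlue u u'), by
        rintro z (rfl | hz)
        · exact le_max_left _ _
        · exact hz.le_ribbonGlue.trans (le_max_right _ _)⟩ ⟨0, .inl rfl⟩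
    by_cases hs : ∃ p m, IsMinSplit u P u' p m
    · obtain ⟨p, m, hs⟩ := hs
      refine .inr (.inl ⟨_, .deltaAlpha t u t' u' P p m hq hP hs, ?_⟩)
      simpa [Decreases] using (slideRight_spec hx hy hP.1 hs.1 t (t + P - u'.length)).2.2
    · have hadm : InScolc u P u' := by
        rcases hP.1 with rfl | h
        · -- No split on top of `u`: the first box of `u` and the last box of `u'` can share a row.
          exfalso
          have h1 : InScolc u 1 u' := by
            refine ⟨⟨le_rfl, by omega⟩, fun i j hij a ha b hb => ?_⟩
            by_contra! hba
            obtain ⟨hi, rfl⟩ := List.getElem?_eq_some_iff.1 (Option.mem_def.1 ha)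
            obtain ⟨hj, rfl⟩ := List.getElem?_eq_some_iff.1 (Option.mem_def.1 hb)
            obtain rfl : i = 0 := by omega
            obtain rfl : j = u'.length - 1 := by omega
            exact hs (exists_isMinSplit ⟨0, u'.length, hk, hl, le_rfl, by simp,
              by simpa [hi, hj] using hba, by simp⟩)
          have := hP.2 (.inr h1 : (1 : ℤ) ∈ {P : ℤ | P = 0 ∨ InScolc u P u'})
          omega
        · exact h
      have hP' : IsGreatest {P : ℤ | InScolc u P u'} P := ⟨hadm, fun z hz => hP.2 (.inr hz)⟩
      obtain rfl := (eq_ribbonGlue_or_exists_isMinSplit hP').resolve_right hs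
      have hle := (inScolc_ribbonGlue hx hy).1 hadm
      have hnc : ¬ RowConnected u (gluingPosition (t, u) (t', u')) u' := fun h =>
        hq ⟨h, fun i j _ a ha b hb => hle a (List.mem_of_getElem? ha) b (List.mem_of_getElem? hb)⟩
      have hglued (t'' : ℤ) (h : t'' = t + ribbonGlue u u' - u'.length) :
          RibbonGlued (t, u) (t'', u') := by
        subst h
        exact ⟨hmove _, hadm⟩
      refine .inr (.inr ?_)
      by_cases hq1 : gluingPosition (t, u) (t', u') < 1
      · refine ⟨_, .gamma t u t' u' _ (.inr ⟨hq1, fun a ha b hb => hle a (List.mem_of_mem_head? ha)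
          b (List.mem_of_getLast? hb)⟩) hP' ?_, .inl (hglued _ rfl)⟩
        rintro h
        exact hnc (h ▸ hadm.1)
      · refine ⟨_, .delta t u t' u' ?_ hnc fun a ha b hb => hle a (List.mem_of_getLast? ha) b
          (List.mem_of_mem_head? hb), .inl (hglued _ ?_)⟩
        · rw [RowConnected] at hnc
          omega
        · simp only [ribbonGlue]
          omega

theorem not_rule_of_ribbonGlued (h : RibbonGlued x y) : ¬ Rule x y T := by
  rintro (⟨t, u, t', u', p, m, h', hs⟩ | ⟨t, u, t', u', P, p, m, h', hP, hs⟩ |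
    ⟨t, u, t', u', P, h', hP, hne⟩ | ⟨t, u, t', u', hq, hc, h'⟩)
  · obtain ⟨⟨h1, h2, -, h4, -⟩, -⟩ := hs
    have := h.1
    simp only [ribbonGlue] at this
    omega
  · exact h' (h.1 ▸ h.2)
  · refine hne (le_antisymm ?_ (hP.2 (h.1 ▸ h.2)))
    rw [h.1]
    exact InScolc.le_ribbonGlue hP.1
  · exact hc (h.1 ▸ h.2.1)

theorem zipWith_eq_and_isChain_iff : (List.zipWith gluingPosition D D.tail =
      List.zipWith ribbonGlue (D.map (fun x => x.2)) (D.map (fun x => x.2)).tail ∧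
    (D.map (fun x => x.2)).IsChain (fun u u' => InScolc u (ribbonGlue u u') u')) ↔
      D.IsChain RibbonGlued := by
  induction D with
  | nil => simp
  | cons x D ih =>
    cases D with
    | nil => simp
    | cons y D =>
      rw [List.isChain_cons_cons, ← ih]
      simp only [List.tail_cons, List.zipWith_cons_cons, List.map_cons, List.cons.injEq,
        List.isChain_cons_cons, RibbonGlued]
      tauto

theorem ofPlaced_mem_quasiRibbon_iff (hD : PlacedColumns D) :
    ofPlaced D ∈ QuasiRibbon n ↔ D.IsChain RibbonGlued := by
  rw [← zipWith_eq_and_isChain_iff, QuasiRibbon, Set.mem_ofPred_eq,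
    and_iff_right (ofPlaced_mem_Scol_iff.2 hD)]
  simp [ofPlaced, ofGluingMap]

theorem exists_ofPlaced_eq {w : GluedString n} (hw : w ∈ Scol n) :
    ∃ D, PlacedColumns D ∧ ofPlaced D = w := by
  suffices h : ∀ (L : List (List (Fin n))) (c : List (Fin n)) (Q : List ℤ) (t : ℤ),
      Q.length = L.length → ∃ D : List (Placed n), ((t, c) :: D).map (fun x => x.2) = c :: L ∧
        List.zipWith gluingPosition ((t, c) :: D) D = Q by
    obtain ⟨L, Q⟩ := w
    obtain ⟨hL, hQ⟩ := hw
    simp only at hL hQ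
    cases L with
    | nil => exact ⟨[], by simp [PlacedColumns], by simpa [ofPlaced] using hQ⟩
    | cons c L =>
      obtain ⟨D, h1, h2⟩ := h L c Q 0 (by simpa using hQ)
      refine ⟨(0, c) :: D, ?_, by simp only [ofPlaced, h1, List.tail_cons, h2]⟩
      intro x hx
      exact hL x.2 (h1 ▸ List.mem_map_of_mem hx)
  intro L
  induction L with
  | nil => exact fun c Q t hQ => ⟨[], by simp, by simpa using hQ⟩
  | cons c' L ih =>
    intro c Q t hQ
    cases Q with
    | nil => simp at hQ
    | cons q Q =>
      obtain ⟨D, h1, h2⟩ := ih c' Q (t + q - c'.length) (by simpa using hQ)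
      refine ⟨(t + q - c'.length, c') :: D, by simpa using h1, ?_⟩
      rw [List.zipWith_cons_cons, h2]
      simp [gluingPosition]

theorem Step.mem_and_hypoplactic {w w' : GluedString n} (h : Step w w') :
    w' ∈ Scol n ∧ Hypoplactic (readSW w) (readSW w') := by
  obtain ⟨hw, A, B, x, y, T, hr, rfl, rfl⟩ := h
  have C := Hypoplactic.isWordCongruence (α := Fin n)
  rw [ofPlaced_mem_Scol_iff] at hw ⊢
  obtain ⟨h1, h2⟩ := hr.spec (hw x (by simp)) (hw y (by simp))
  constructor
  · intro z hz
    simp only [List.mem_append] at hz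
    rcases hz with (hz | hz) | hz
    · exact hw z (by simp [hz])
    · exact h1 z hz
    · exact hw z (by simp [hz])
  · simp only [readSW_ofPlaced, placedReading_append]
    exact C.append (C.append (C.refl _) h2) (C.refl _)

theorem reflTransGen_mem_and_hypoplactic {w w' : GluedString n} (hw : w ∈ Scol n)
    (h : Relation.ReflTransGen Step w w') :
    w' ∈ Scol n ∧ Hypoplactic (readSW w) (readSW w') := by
  have C := Hypoplactic.isWordCongruence (α := Fin n)
  induction h with
  | refl => exact ⟨hw, C.refl _⟩
  | tail _ hs ih =>
    obtain ⟨h1, h2⟩ := hs.mem_and_hypoplactic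
    exact ⟨h1, C.trans ih.2 h2⟩

/-- The irreducible strings of columns are the quasi-ribbon tableaux. -/
theorem irreducible_iff {v : GluedString n} (hv : v ∈ Scol n) :
    (∀ v', ¬ Step v v') ↔ v ∈ QuasiRibbon n := by
  constructor
  · intro h
    obtain ⟨D, hD, rfl⟩ := exists_ofPlaced_eq hv
    rw [ofPlaced_mem_quasiRibbon_iff hD, List.isChain_iff_forall_rel_of_append_cons_cons]
    rintro x y A B rfl
    have hstep (T) (hT : Rule x y T) : False :=
      h _ ⟨hv, A, B, x, y, T, hT, by simp, rfl⟩
    rcases ribbonGlued_or_exists_rule (hD x (by simp)) (hD y (by simp)) with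
      h' | ⟨T, hT, -⟩ | ⟨t', hT, -⟩
    · exact h'
    · exact (hstep _ hT).elim
    · exact (hstep _ hT).elim
  · rintro hv' _ ⟨_, A, B, x, y, T, hT, rfl, -⟩
    rw [ofPlaced_mem_quasiRibbon_iff (ofPlaced_mem_Scol_iff.1 hv),
      List.isChain_iff_forall_rel_of_append_cons_cons] at hv'
    exact not_rule_of_ribbonGlued (hv' (l₁ := A) (l₂ := B) (by simp)) hT

/-! ### Existence of normal forms -/

theorem reflTransGen_of_rule {A B : List (Placed n)} (hD : PlacedColumns (A ++ x :: y :: B))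
    (h : Rule x y T) : Relation.ReflTransGen Step (ofPlaced (A ++ x :: y :: B))
      (ofPlaced (A ++ T ++ B)) :=
  .single ⟨ofPlaced_mem_Scol_iff.2 hD, A, B, x, y, T, h, by simp, rfl⟩

/-- Treating the pairs of adjacent columns from left to right, either all of them become glued as in
a ribbon, or a slide occurs. -/
theorem exists_reduction (B A : List (Placed n)) (x : Placed n)
    (hD : PlacedColumns (A ++ x :: B)) (hA : (A ++ [x]).IsChain RibbonGlued) :
    ∃ D, Relation.ReflTransGen Step (ofPlaced (A ++ x :: B)) (ofPlaced D) ∧ PlacedColumns D ∧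
      (D.IsChain RibbonGlued ∨ placedReading D < placedReading (A ++ x :: B) ∨
        placedReading D = placedReading (A ++ x :: B) ∧ D.length < (A ++ x :: B).length) := by
  induction B generalizing A x with
  | nil => exact ⟨_, .refl, hD, .inl hA⟩
  | cons y B ih =>
    have hx := hD x (by simp)
    have hy := hD y (by simp)
    -- A slide of the pair ends the reduction; a ribbon gluing of the pair allows to go on.
    have hgoal (y' : Placed n) (hy' : y'.2 = y.2) (h : RibbonGlued x y' ∨
        ∃ T, Rule x y' T ∧ Decreases x y' T) :
        ∃ D, Relation.ReflTransGen Step (ofPlaced (A ++ x :: y' :: B)) (ofPlaced D) ∧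
          PlacedColumns D ∧ (D.IsChain RibbonGlued ∨
            placedReading D < placedReading (A ++ x :: y :: B) ∨
            placedReading D = placedReading (A ++ x :: y :: B) ∧
              D.length < (A ++ x :: y :: B).length) := by
      have hD' : PlacedColumns (A ++ x :: y' :: B) := by
        intro z hz
        simp only [List.mem_append, List.mem_cons] at hz
        rcases hz with hz | rfl | rfl | hz
        · exact hD z (by simp [hz])
        · exact hx
        · exact hy' ▸ hy
        · exact hD z (by simp [hz])
      rcases h with h | ⟨T, hT, hdec⟩
      · obtain ⟨D, h1, h2, h3⟩ := ih (A ++ [x]) y' (by simpa using hD')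
          (by simpa using ⟨hA, h⟩)
        refine ⟨D, by simpa using h1, h2, ?_⟩
        simpa [hy'] using h3
      · have hs := reflTransGen_of_rule hD' hT
        refine ⟨_, hs, ofPlaced_mem_Scol_iff.1
          (reflTransGen_mem_and_hypoplactic (ofPlaced_mem_Scol_iff.2 hD') hs).1, .inr ?_⟩
        have e : placedReading (A ++ x :: y :: B) =
            placedReading A ++ placedReading [x, y'] ++ placedReading B := by simp [hy']
        rw [e, placedReading_append, placedReading_append]
        rcases hdec with h | ⟨h, h'⟩
        · exact .inl (h.lt _ _)
        · refine .inr ⟨by rw [h], ?_⟩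
          simp only [List.length_append, List.length_cons]
          omega
    rcases ribbonGlued_or_exists_rule hx hy with h | h | ⟨t', hT, h⟩
    · exact hgoal y rfl (.inl h)
    · exact hgoal y rfl (.inr h)
    · obtain ⟨D, h1, h2⟩ := hgoal (t', y.2) rfl h
      refine ⟨D, .trans ?_ h1, h2⟩
      simpa using reflTransGen_of_rule hD hT

theorem wellFoundedLT_words (n N : ℕ) : WellFoundedLT {w : List (Fin n) // w.length = N} := by
  have : Finite {w : List (Fin n) // w.length = N} :=
    inferInstanceAs (Finite (List.Vector (Fin n) N))
  infer_instance

theorem exists_reflTransGen_quasiRibbon (hD : PlacedColumns D) :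
    ∃ v ∈ QuasiRibbon n, Relation.ReflTransGen Step (ofPlaced D) v := by
  have hwf := wellFoundedLT_words n (placedReading D).length
  suffices h : ∀ (w : {w : List (Fin n) // w.length = (placedReading D).length}) (k : ℕ)
      (E : List (Placed n)), PlacedColumns E → placedReading E = w.1 → E.length = k →
      ∃ v ∈ QuasiRibbon n, Relation.ReflTransGen Step (ofPlaced E) v from
    h ⟨_, rfl⟩ _ D hD rfl rfl
  intro w
  induction w using WellFoundedLT.induction with
  | ind w ihw =>
    intro k
    induction k using Nat.strong_induction_on with
    | h k ihk =>
      intro E hE hw hk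
      cases E with
      | nil => exact ⟨_, emptyString_mem_quasiRibbon, .refl⟩
      | cons x B =>
        obtain ⟨E', h1, h2, h3⟩ := exists_reduction B [] x hE (by simp)
        rw [List.nil_append] at h1 h3
        have hlen : (placedReading E').length = (placedReading D).length := by
          have h := (reflTransGen_mem_and_hypoplactic (ofPlaced_mem_Scol_iff.2 hE) h1).2.1.length_eq
          rw [readSW_ofPlaced, readSW_ofPlaced] at h
          rw [← h, hw, w.2]
        rcases h3 with h3 | h3 | ⟨h3, h4⟩
        · exact ⟨_, (ofPlaced_mem_quasiRibbon_iff h2).2 h3, h1⟩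
        · obtain ⟨v, hv, hv'⟩ := ihw ⟨_, hlen⟩ (Subtype.mk_lt_mk.2 (hw ▸ h3)) _ E' h2 rfl rfl
          exact ⟨v, hv, h1.trans hv'⟩
        · obtain ⟨v, hv, hv'⟩ := ihk E'.length (hk ▸ h4) E' h2 (h3.trans hw) rfl
          exact ⟨v, hv, h1.trans hv'⟩

/-- A string of columns has exactly one normal form; it is the quasi-ribbon tableau whose reading is
in the same hypoplactic class. -/
theorem existsUnique_isNormalFormOf {w : GluedString n} (hw : w ∈ Scol n) :
    ∃! v, IsNormalFormOf w v := by
  have C := Hypoplactic.isWordCongruence (α := Fin n)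
  obtain ⟨D, hD, rfl⟩ := exists_ofPlaced_eq hw
  obtain ⟨v, hv, hwv⟩ := exists_reflTransGen_quasiRibbon hD
  obtain ⟨h1, h2⟩ := reflTransGen_mem_and_hypoplactic hw hwv
  refine ⟨v, ⟨hwv, (irreducible_iff h1).2 hv⟩, fun v' hv' => ?_⟩
  obtain ⟨h3, h4⟩ := reflTransGen_mem_and_hypoplactic hw hv'.1
  exact eq_of_hypoplactic_readSW ((irreducible_iff h3).1 hv'.2) hv (C.trans (C.symm h4) h2)

theorem isNormalFormOf_rba {w : GluedString n} (hw : w ∈ Scol n) : IsNormalFormOf w (rba w) := by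
  have h : ∃ v, IsNormalFormOf w v := (existsUnique_isNormalFormOf hw).exists
  rw [rba, dif_pos h]
  exact h.choose_spec

theorem rba_mem_and_hypoplactic {w : GluedString n} (hw : w ∈ Scol n) :
    rba w ∈ QuasiRibbon n ∧ Hypoplactic (readSW w) (readSW (rba w)) := by
  have h := isNormalFormOf_rba hw
  obtain ⟨h1, h2⟩ := reflTransGen_mem_and_hypoplactic hw h.1
  exact ⟨(irreducible_iff h1).1 h.2, h2⟩

theorem rba_eq_of_hypoplactic {w v : GluedString n} (hw : w ∈ Scol n) (hv : v ∈ QuasiRibbon n)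
    (h : Hypoplactic (readSW w) (readSW v)) : rba w = v := by
  have C := Hypoplactic.isWordCongruence (α := Fin n)
  obtain ⟨h1, h2⟩ := rba_mem_and_hypoplactic hw
  exact eq_of_hypoplactic_readSW h1 hv (C.trans (C.symm h2) h)

/-! ### The morphisms -/

theorem rba_emptyString : rba (emptyString n) = emptyString n :=
  rba_eq_of_hypoplactic emptyString_mem_young.1 emptyString_mem_quasiRibbon
    (Hypoplactic.isWordCongruence.refl _)

theorem isRightMorphism_rba :
    StringData.IsRightMorphism (Yrow n) (Qrow n) rba where
  mapsTo _ hd := (rba_mem_and_hypoplactic hd.1).1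
  map_empty := rba_emptyString
  map_ins d hd x := by
    have C := Hypoplactic.isWordCongruence (α := Fin n)
    obtain ⟨h1, h2⟩ := schenstedRight_mem_and_read hd x
    obtain ⟨h3, h4⟩ := rba_mem_and_hypoplactic hd.1
    obtain ⟨h5, h6⟩ := quasiRight_mem_and_read h3 x
    exact rba_eq_of_hypoplactic h1.1 h5
      (C.trans h2.hypoplactic (C.trans (C.append h4 (C.refl [x])) (C.symm h6)))
  constr_read d hd := by
    have C := Hypoplactic.isWordCongruence (α := Fin n)
    have h (u : List (Fin n)) := StringData.insRight_mem_and_read (S := Qrow n) C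
      (isRight_Qrow.ins_mem) (fun _ hd x => (quasiRight_mem_and_read hd x).2)
      isRight_Qrow.empty_mem u
    refine eq_of_hypoplactic_readSW (h _).1 (h _).1 (C.trans (h _).2 (C.symm ?_))
    exact C.trans (h _).2 (C.symm (rba_mem_and_hypoplactic hd.1).2)

theorem isLeftMorphism_rba :
    StringData.IsLeftMorphism (Ycol n) (Qleft n) rba where
  mapsTo _ hd := (rba_mem_and_hypoplactic hd.1).1
  map_empty := rba_emptyString
  map_ins d hd x := by
    have C := Hypoplactic.isWordCongruence (α := Fin n)
    obtain ⟨h3, h4⟩ := rba_mem_and_hypoplactic hd.1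
    obtain ⟨h5, h6⟩ := quasiLeft_mem_and_read h3 x
    exact rba_eq_of_hypoplactic (schenstedLeft_mem hd x).1 h5
      (C.trans (plactic_readSW_schenstedLeft hd x).hypoplactic
        (C.trans (C.append (C.refl [x]) h4) (C.symm h6)))
  constr_read d hd := by
    have C := Hypoplactic.isWordCongruence (α := Fin n)
    have h (u : List (Fin n)) := StringData.insLeft_mem_and_read (S := Qleft n) C
      (isLeft_Qleft.ins_mem) (fun _ hd x => (quasiLeft_mem_and_read hd x).2)
      isLeft_Qleft.empty_mem u
    refine eq_of_hypoplactic_readSW (h _).1 (h _).1 (C.trans (h _).2 (C.symm ?_))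
    exact C.trans (h _).2 (C.append (C.symm (rba_mem_and_hypoplactic hd.1).2) (C.refl _))

/-- A quasi-ribbon tableau is the rectification of the Young tableau in the plactic class of its
reading. -/
theorem surjOn_rba : Set.SurjOn rba (Young n) (QuasiRibbon n) := by
  intro v hv
  obtain ⟨h1, h2⟩ := StringData.insLeft_mem_and_read (S := Ycol n) Plactic.isWordCongruence
    isLeft_Ycol.ins_mem (fun _ hd x => plactic_readSW_schenstedLeft hd x) isLeft_Ycol.empty_mem
    (readSW v)
  refine ⟨_, h1, rba_eq_of_hypoplactic h1.1 hv ?_⟩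
  have h3 := h2.hypoplactic
  rw [isLeft_Ycol.read_empty, List.append_nil] at h3
  exact h3

end Sliding

end StringColumns

theorem theoremT (n : ℕ) :
    (∀ d ∈ StringColumns.Young n,
      StringColumns.IsNormalFormOf d (StringColumns.rba d) ∧
        ∀ v, StringColumns.IsNormalFormOf d v → v = StringColumns.rba d) ∧
    ((StringColumns.Yrow n).IsRight ∧ (StringColumns.Qrow n).IsRight ∧
      StringColumns.StringData.IsRightMorphism (StringColumns.Yrow n) (StringColumns.Qrow n)
        StringColumns.rba) ∧
    ((StringColumns.Ycol n).IsLeft ∧ (StringColumns.Qleft n).IsLeft ∧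
      StringColumns.StringData.IsLeftMorphism (StringColumns.Ycol n) (StringColumns.Qleft n)
        StringColumns.rba) ∧
    Set.SurjOn StringColumns.rba (StringColumns.Young n) (StringColumns.QuasiRibbon n) := by
  open StringColumns in
  exact ⟨fun d hd => ⟨isNormalFormOf_rba hd.1, fun v hv =>
      (existsUnique_isNormalFormOf hd.1).unique hv (isNormalFormOf_rba hd.1)⟩,
    ⟨isRight_Yrow, isRight_Qrow, isRightMorphism_rba⟩,
    ⟨isLeft_Ycol, isLeft_Qleft, isLeftMorphism_rba⟩, surjOn_rba⟩
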